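/- **Setting.** Let $p\ge 3$. A *cyclic forest of perimeter $p$* is a rooted planar map $F$ with two faces whose root face has a simple boundary of length $p$; a *blossom* is a vertex of degree one, a *stem* is an edge incident to a blossom, and all other vertices and edges are *proper*. $F$ is a *blossoming forest* if every vertex of degree $>1$ not on the root face is adjacent to exactly two blossoms, and exactly $p-3$ blossoms are adjacent to a vertex of the root face. For an oriented edge $uv$, $\kappa^\ell(uv)$ is the corner at $u$ just before $uv$ in clockwise order around $u$. Let $\xi^\dagger=\xi(0),\xi(1),\dots,\xi(N-1)$ be the corners of the non-root face of $F$ in clockwise contour order, $\xi^\dagger$ being the corner that follows the root corner clockwise around the root vertex, and let $\xi^\circ=\xi(N)$ be an additional last corner, a duplicate of $\xi^\dagger$. Labels: $\lambda(\xi(0))=0$, and $\lambda(\xi(i+1))-\lambda(\xi(i))$ is $+1$ if $\xi(i)$ is at a blossom, $0$ if $\xi(i+1)$ is at a blossom, and $-1$ otherwise (so $\lambda(\xi^\circ)=-3$). Let $\ell_{\min}$ be the minimal label ($\xi^\circ$ included), $\kappa_{\min}$ the first corner in contour order ($\xi^\circ$ included) with label $\ell_{\min}$, and $v^\star$ its vertex.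 For a proper vertex $u$, $X(u)$ is the minimal label of a corner at $u$ ($\xi^\circ$ excluded). Let $M=\chi(F)$ be the closure of $F$: as long as some stem $\{u,b\}$ ($b$ a blossom) is followed in the clockwise contour by two proper edges $\{u,v\},\{v,w\}$, replace it by a (proper) edge $\{u,w\}$ that has the non-root (unbounded) face on its left when oriented from $u$ to $w$. The marked face of $M$ is the face that remains. The vertices and edges of $M$ are identified with the proper vertices and the edges of $F$; the edges coming from proper edges of $F$ are *tree-edges*. Corners of $M$ inherit the labels of the corners of $F$ of which they are pieces, and $\lambda^\ell(uv)=\lambda(\kappa^\ell(uv))$. Let $\overrightarrow O$ be the minimal $3$-orientation of $M$: every vertex not on the root face has outdegree $3$, the boundary of the root face is a clockwise cycle, and there is no counterclockwise cycle, where a directed cycle is clockwise (counterclockwise) if the marked face is on its left (right). **Statement.** Let $v_0v_1\in\overrightarrow O$. There is a unique modified leftmost path started from $v_0v_1$, that is, a unique sequence of oriented edges $v_0v_1,v_1v_2,\dots$ such that, for $i\ge1$, $v_iv_{i+1}$ is the first edge at $v_i$ after $v_{i-1}v_i$, in clockwise order around $v_i$, such that $v_iv_{i+1}$ is a tree-edge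 or $v_iv_{i+1}\in\overrightarrow O$. There exists $i$ with $v_i=v^\star$. Set $$L=\lambda^\ell(v_0v_1)-\lambda(\kappa_{\min})+3\delta,$$ where $\delta=0$ if $\kappa^\ell(v_0v_1)$ lies between $\xi^\dagger$ and $\kappa_{\min}$ (both included) in contour order, and $\delta=1$ otherwise. Then $L\ge 0$ and $L$ is the first index at which the path is at the corner $\kappa_{\min}$, i.e. the smallest $i\ge0$ with $\kappa^\ell(v_iv_{i+1})=\kappa_{\min}$ (when $\kappa_{\min}=\xi^\circ$, for $i\ge1$ the corner $\xi^\dagger$ is identified with its duplicate $\xi^\circ$, while the starting corner $\xi^\dagger$ is not); in particular $v_L=v^\star$. If moreover $\kappa_{\min}$ is the first corner at $v^\star$ met when one follows the contour of $F$ cyclically from $\kappa^\ell(v_0v_1)$ (included), then $L=\min\{i\ge0 : v_i=v^\star\}$. Consequently, for every vertex $u$ of $M$, the graph distance in $M$ satisfies $d_M(u,v^\star)\le X(u)-\ell_{\min}+3$. -/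

import Mathlib

/-- A rooted map on an oriented surface, given by its darts (oriented edges).
`σ d` is the dart that follows `d` in clockwise order around the origin of `d`,
`α d` is the dart `d` with the opposite direction, and `d ↦ ` (corner at the origin of `d` that
comes just before `d` in clockwise order) identifies darts with corners; this corner is the corner
`κ^ℓ(d)`, and it lies in the face to the left of `d`.
`root` is the dart that represents the root corner. -/
structure PlaneMap (D : Type*) where
  /-- clockwise rotation around the vertices -/
  σ : Equiv.Perm D
  /-- reversal of darts -/
  α : Equiv.Perm D
  α_invol : ∀ d, α (α d) = d
  α_ne : ∀ d, α d ≠ d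
  /-- the root corner -/
  root : D

namespace PlaneMap

variable {D : Type*}

/-- Walk with the face on the left: arrive along `d`, leave by the next dart in clockwise order.
The cycles of `φ` are the faces; the face of `d` is the face on the left of `d`. -/
def φ (F : PlaneMap D) : Equiv.Perm D := F.α.trans F.σ

/-- The vertices: cycles of `σ`. -/
def Vertex (F : PlaneMap D) : Type _ := Quotient (Equiv.Perm.SameCycle.setoid F.σ)

/-- The faces: cycles of `φ`. -/
def Face (F : PlaneMap D) : Type _ := Quotient (Equiv.Perm.SameCycle.setoid F.φ)

/-- The (unoriented) edges: cycles of `α`. -/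
def Edge (F : PlaneMap D) : Type _ := Quotient (Equiv.Perm.SameCycle.setoid F.α)

/-- The origin of a dart. -/
def vert (F : PlaneMap D) (d : D) : F.Vertex := Quotient.mk (Equiv.Perm.SameCycle.setoid F.σ) d

/-- The face on the left of a dart. -/
def face (F : PlaneMap D) (d : D) : F.Face := Quotient.mk (Equiv.Perm.SameCycle.setoid F.φ) d

/-- The underlying simple graph of a map. -/
def graph (F : PlaneMap D) : SimpleGraph F.Vertex :=
  SimpleGraph.fromRel fun u v => ∃ d, F.vert d = u ∧ F.vert (F.α d) = v

/-- The map is connected, and is drawn on the sphere (Euler's formula). -/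
def IsPlanar (F : PlaneMap D) : Prop :=
  F.graph.Connected ∧ Nat.card F.Vertex + Nat.card F.Face = Nat.card F.Edge + 2

/-- The vertex at the origin of `d` is incident to the root face. -/
def OnRootFace (F : PlaneMap D) (d : D) : Prop :=
  ∃ x, F.face x = F.face F.root ∧ F.vert x = F.vert d

/-- Cyclic forest of perimeter `p`: a planar map with two faces whose root face has a simple
boundary, of length `p`. -/
def IsCyclicForest (F : PlaneMap D) (p : ℕ) : Prop :=
  F.IsPlanar ∧ Nat.card F.Face = 2 ∧
  (∀ x y, F.face x = F.face F.root → F.face y = F.face F.root → F.vert x = F.vert y → x = y) ∧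
  {x | F.face x = F.face F.root}.ncard = p

/-- The origin of `d` has degree one; in a blossoming forest, it is a blossom. -/
def IsBlossom (F : PlaneMap D) (d : D) : Prop := F.σ d = d

/-- Neither end of `d` is a blossom: `d` is a proper edge (the other edges are the stems). -/
def IsProper (F : PlaneMap D) (d : D) : Prop := ¬ F.IsBlossom d ∧ ¬ F.IsBlossom (F.α d)

/-- Rooted blossoming forest of perimeter `p`. -/
def IsBlossomingForest (F : PlaneMap D) (p : ℕ) : Prop :=
  3 ≤ p ∧ F.IsCyclicForest p ∧
  (∀ x, ¬ F.OnRootFace x → ¬ F.IsBlossom x →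
    {d | F.vert d = F.vert x ∧ F.IsBlossom (F.α d)}.ncard = 2) ∧
  {b | F.IsBlossom b ∧ F.OnRootFace (F.α b)}.ncard + 3 = p

/-! ### Contour order and labels of a blossoming forest -/

/-- The contour sequence `ξ(0) = ξ†, ξ(1), …` of the corners of the non-root face. Here `ξ†` is the
corner that follows the root corner clockwise around the root vertex. -/
def ξ (F : PlaneMap D) (i : ℕ) : D := (F.φ ^ i) (F.σ F.root)

/-- The number of corners in the non-root face. The corners of the non-root face are
`ξ(0), …, ξ(N-1)`; the index `N` stands for `ξ°`, the additional last corner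
obtained by duplicating `ξ†`. -/
noncomputable def N (F : PlaneMap D) : ℕ := Function.minimalPeriod F.φ (F.σ F.root)

open Classical in
/-- The labels along the contour: `F.lam i` is the label of `ξ(i)` for `i < N`, and `F.lam N` is
the label of `ξ°`. -/
noncomputable def lam (F : PlaneMap D) : ℕ → ℤ
  | 0 => 0
  | i + 1 =>
    if F.IsBlossom (F.ξ i) then F.lam i + 1
    else if F.IsBlossom (F.ξ (i + 1)) then F.lam i
    else F.lam i - 1

/-- The position in the contour of the corner `d` (a corner of the non-root face). -/
noncomputable def pos (F : PlaneMap D) (d : D) : ℕ := sInf {i | F.ξ i = d}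

/-- The label `λ(d)` of the corner `d = κ^ℓ(d)` (a corner of the non-root face). A closure has the
same darts; if the origin of `d` is not a blossom, the corner `κ^ℓ(d)` of the closure is a piece of
the corner `κ^ℓ(d)` of the forest, and inherits its label. -/
noncomputable def label (F : PlaneMap D) (d : D) : ℤ := F.lam (F.pos d)

/-- The position of `κ_min`, the first corner (`ξ°` included) whose label is minimal. -/
noncomputable def minPos (F : PlaneMap D) : ℕ :=
  sInf {i | i ≤ F.N ∧ ∀ j ≤ F.N, F.lam i ≤ F.lam j}

/-- The minimal label `ℓ_min = λ(κ_min)`. -/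
noncomputable def minLabel (F : PlaneMap D) : ℤ := F.lam F.minPos

/-- The dart just after the corner `κ_min`; its origin is `v*`. -/
noncomputable def minDart (F : PlaneMap D) : D := F.ξ F.minPos

/-- The label `X(v)` of the proper vertex `v` at the origin of `x`: the minimum of the labels of the
corners at `v` in the non-root face, `ξ°` excluded. -/
noncomputable def vertexLabel (F : PlaneMap D) (x : D) : ℤ :=
  sInf {l | ∃ i < F.N, F.vert (F.ξ i) = F.vert x ∧ F.lam i = l}

/-- `j` is the position of a corner met when one follows the contour cyclically from the corner at
position `a` (included) until `κ_min` (excluded). -/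
def Before (F : PlaneMap D) (a j : ℕ) : Prop :=
  (a ≤ F.minPos ∧ a ≤ j ∧ j < F.minPos) ∨
  (F.minPos < a ∧ ((a ≤ j ∧ j ≤ F.N) ∨ j < F.minPos))

end PlaneMap

/-- A map with a marked face, the face on the left of the dart `mark`. -/
structure MarkedMap (D : Type*) extends PlaneMap D where
  mark : D

namespace MarkedMap

variable {D : Type*}

/-- Replace the stem `{u, b}`, followed in the clockwise contour by `{u, v}` and `{v, w}`, by an edge
`{u, w}`: the dart `b`, which was alone around the blossom, now starts at `w`, just before the dart
`φ³ b` that follows `{v, w}` in the contour. The marked face is the one to the left of the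
new edge, oriented from `u` to `w`. -/
def close [DecidableEq D] (M : MarkedMap D) (b : D) : MarkedMap D :=
  { M with
    σ := Equiv.swap b ((M.φ ^ 3) b) * M.σ
    mark := M.α b }

/-- `M'` is obtained from `M` by one local closure. -/
def LocalClosure [DecidableEq D] (M M' : MarkedMap D) : Prop :=
  ∃ b, M.IsBlossom b ∧ M.IsProper (M.φ b) ∧ M.IsProper ((M.φ ^ 2) b) ∧ M' = M.close b

/-- `M` is the closure `χ(F)` of `F`: start from `F`, with its non-root face marked, and
perform local closures until none is possible. -/
def IsClosure [DecidableEq D] (M : MarkedMap D) (F : PlaneMap D) : Prop :=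
  Relation.ReflTransGen LocalClosure ⟨F, F.σ F.root⟩ M ∧ ∀ M', ¬ LocalClosure M M'

/-- `c` is a (simple) directed cycle made of darts of `O`. -/
def IsDirectedCycle (M : MarkedMap D) (O : Set D) {n : ℕ} (c : ZMod n → D) : Prop :=
  (∀ i, c i ∈ O) ∧ (∀ i, M.vert (M.α (c i)) = M.vert (c (i + 1))) ∧
  (∀ i j, M.vert (c i) = M.vert (c j) → i = j)

/-- One step in the sphere minus the cycle `c`: stay in the same face, or cross an edge that
does not belong to `c`. -/
def Step (M : MarkedMap D) {n : ℕ} (c : ZMod n → D) (x y : D) : Prop :=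
  y = M.φ x ∨ (y = M.α x ∧ ∀ i, c i ≠ x ∧ c i ≠ M.α x)

/-- The marked face lies on the right of the cycle `c`: it can be joined to the face on the right
of some dart of `c` without crossing `c`. -/
def MarkedOnRight (M : MarkedMap D) {n : ℕ} (c : ZMod n → D) : Prop :=
  ∃ i, Relation.ReflTransGen (M.Step c) (M.α (c i)) M.mark

/-- `O` is a minimal `3`-orientation: every edge gets one direction, inner vertices have outdegree
three, the boundary of the root face is a clockwise cycle (it has the root face on its right, the
marked face on its left), and there is no counterclockwise cycle, that is, no directed cycle with
the marked face on its right. -/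
def IsMinimalOrientation (M : MarkedMap D) (O : Set D) : Prop :=
  (∀ d, d ∈ O ↔ M.α d ∉ O) ∧
  (∀ x, ¬ M.OnRootFace x → {d | M.vert d = M.vert x ∧ d ∈ O}.ncard = 3) ∧
  (∀ d, M.face d = M.face M.root → M.α d ∈ O) ∧
  (∀ (n : ℕ) (c : ZMod n → D), 0 < n → M.IsDirectedCycle O c → ¬ M.MarkedOnRight c)

/-- The sequence of darts `v₀v₁, v₁v₂, …` of a modified leftmost path: it starts in `O`, and
`v_{i+1}v_{i+2}` is the first dart after `v_{i+1}v_i`, clockwise around `v_{i+1}`, that is a tree-edge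
(a proper edge of `F`) or belongs to `O`. -/
def IsModifiedLeftmost (M : MarkedMap D) (F : PlaneMap D) (O : Set D) (e : ℕ → D) : Prop :=
  e 0 ∈ O ∧ ∀ i, ∃ k, 0 < k ∧ e (i + 1) = (M.σ ^ k) (M.α (e i)) ∧
    (F.IsProper (e (i + 1)) ∨ e (i + 1) ∈ O) ∧
    ∀ j, 0 < j → j < k →
      ¬ (F.IsProper ((M.σ ^ j) (M.α (e i))) ∨ (M.σ ^ j) (M.α (e i)) ∈ O)

end MarkedMap

/-! The crux is that the minimal `3`-orientation directs every stem towards its blossom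
(`IsMinimalOrientation.notMem_of_isBlossom`). A modified leftmost path therefore turns clockwise to
the first dart that does not start at a blossom of `F`, skipping exactly the darts that the closure
has attached to the vertex (`NextDart`). Such a path can be read on the contour of `F`: after a
tree-edge it is at the next corner, after a closed stem at a later corner, and in both cases this is
the first later corner with a smaller label, smaller by one (`IsSucc`). Positions are unrolled over
several turns, each turn lowering the labels by 3 (`IsBlossomingForest.lam_N`). A chain of such
first passages cannot jump over `κ_min`, so it meets it after as many steps as the label difference,
plus 3 if `κ_min` has to be sought in the next turn (`exists_hitting_time`).

For the orientation, compare `O` with `O₀`, in which stems point to blossoms and tree-edges point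
towards the root cycle. Both have outdegree 3 at inner vertices, so their difference is a conserved
flow and comes from a function `h` on the faces other than the root face (`HasPotentials`). The set
where `h` is maximal is bounded by darts of `O`; if it missed the marked face, there would be a
counterclockwise cycle. The set where `h` is minimal is bounded by darts of `O₀`, and induction on
the local closures shows that such a set cannot miss the marked face (`NoDirectedCut`). Hence the
maximum and the minimum of `h` are both its value at the marked face, `h` is constant, and `O`
agrees with `O₀` on the stems. -/

theorem Equiv.Perm.SameCycle.mem_of_mapsTo {D : Type*} [Finite D] {f : Equiv.Perm D} {x y : D}
    (h : f.SameCycle x y) {S : Set D} (hS : ∀ z ∈ S, f z ∈ S) (hx : x ∈ S) : y ∈ S := by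
  obtain ⟨n, rfl⟩ := h.exists_nat_pow_eq
  clear h
  induction n with
  | zero => simpa using hx
  | succ n ih => rw [pow_succ', Equiv.Perm.mul_apply]; exact hS _ ih

theorem Equiv.Perm.SameCycle.eq_of_forall {D A : Type*} {f : Equiv.Perm D} {x y : D}
    (h : f.SameCycle x y) {g : D → A} (hg : ∀ z, g (f z) = g z) : g x = g y := by
  have hinv : ∀ z, g (f.symm z) = g z := fun z => by
    conv_rhs => rw [← f.apply_symm_apply z, hg]
  obtain ⟨n, rfl⟩ := h
  induction n using Int.induction_on with
  | zero => rfl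
  | succ n ih =>
    rw [add_comm, zpow_add, zpow_one, Equiv.Perm.mul_apply, hg]; exact ih
  | pred n ih =>
    rw [sub_eq_neg_add, zpow_add, zpow_neg_one, Equiv.Perm.mul_apply]
    rw [ih]; exact (hinv _).symm

/-! ### Vertices, faces and contour of a cyclic forest. -/

namespace PlaneMap

variable {D : Type*} (F : PlaneMap D)

theorem φ_apply (d : D) : F.φ d = F.σ (F.α d) := rfl

theorem φ_α (d : D) : F.φ (F.α d) = F.σ d := by rw [φ_apply, F.α_invol]

theorem face_eq_iff {x y : D} : F.face x = F.face y ↔ F.φ.SameCycle x y := Quotient.eq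

theorem vert_eq_iff {x y : D} : F.vert x = F.vert y ↔ F.σ.SameCycle x y := Quotient.eq

@[simp] theorem face_φ (d : D) : F.face (F.φ d) = F.face d := by
  rw [face_eq_iff]; exact Equiv.Perm.sameCycle_apply_left.2 (Equiv.Perm.SameCycle.refl _ _)

@[simp] theorem vert_σ (d : D) : F.vert (F.σ d) = F.vert d := by
  rw [vert_eq_iff]; exact Equiv.Perm.sameCycle_apply_left.2 (Equiv.Perm.SameCycle.refl _ _)

theorem vert_φ (d : D) : F.vert (F.φ d) = F.vert (F.α d) := by simp [φ_apply]

theorem vert_surj (v : F.Vertex) : ∃ d, F.vert d = v := Quotient.exists_rep v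

/-- The darts on the boundary of the root face. -/
def rootFace : Set D := {d | F.face d = F.face F.root}

theorem mem_rootFace {d : D} : d ∈ F.rootFace ↔ F.face d = F.face F.root := Iff.rfl

theorem root_mem : F.root ∈ F.rootFace := rfl

@[simp] theorem φ_mem_rootFace {d : D} : F.φ d ∈ F.rootFace ↔ d ∈ F.rootFace := by
  simp [mem_rootFace]

theorem eq_of_vert_eq_of_isBlossom {b y : D} (hb : F.IsBlossom b) (h : F.vert b = F.vert y) :
    y = b := by
  rw [vert_eq_iff] at h
  obtain ⟨n, rfl⟩ := h
  exact Equiv.Perm.zpow_apply_eq_self_of_apply_eq_self hb n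

theorem isBlossom_σ {x : D} : F.IsBlossom (F.σ x) ↔ F.IsBlossom x := by
  simp [IsBlossom]

theorem isBlossom_φ {x : D} : F.IsBlossom (F.φ x) ↔ F.IsBlossom (F.α x) := by
  rw [φ_apply, isBlossom_σ]

theorem onRootFace_congr {x y : D} (h : F.vert x = F.vert y) : F.OnRootFace x ↔ F.OnRootFace y := by
  simp [OnRootFace, h]

theorem onRootFace_of_mem {x : D} (h : x ∈ F.rootFace) : F.OnRootFace x := ⟨x, h, rfl⟩

theorem onRootFace_α {x : D} (h : x ∈ F.rootFace) : F.OnRootFace (F.α x) :=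
  ⟨F.φ x, by simpa [mem_rootFace] using h, F.vert_φ x⟩

/-- Connectedness in terms of darts: stability under `σ` fills a vertex, and stability under `α`
passes to its neighbours. -/
theorem connected_induction [Finite D] (hc : F.graph.Connected) {S : Set D} (hne : S.Nonempty)
    (hσ : ∀ x ∈ S, F.σ x ∈ S) (hα : ∀ x ∈ S, F.α x ∈ S) (y : D) : y ∈ S := by
  obtain ⟨x, hx⟩ := hne
  have key : ∀ v, F.graph.Reachable (F.vert x) v → ∀ y, F.vert y = v → y ∈ S := by
    intro v hv
    obtain ⟨w⟩ := hv.symm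
    generalize hu : F.vert x = u at w
    induction w with
    | nil =>
      rintro y rfl
      exact (F.vert_eq_iff.1 hu).mem_of_mapsTo hσ hx
    | cons hadj w ih =>
      rintro y rfl
      have ih := ih (by rw [hu] at *; exact ⟨w.reverse⟩) hu
      rw [graph, SimpleGraph.fromRel_adj] at hadj
      obtain ⟨-, ⟨d, h1, h2⟩ | ⟨d, h1, h2⟩⟩ := hadj
      · have := hα _ (ih _ h2)
        rw [F.α_invol] at this
        exact (F.vert_eq_iff.1 h1).mem_of_mapsTo hσ this
      · exact (F.vert_eq_iff.1 h2).mem_of_mapsTo hσ (hα _ (ih _ h1))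
  exact key _ (hc.preconnected _ _) y rfl

section Forest

variable {F} {p : ℕ}

theorem IsCyclicForest.connected (h : F.IsCyclicForest p) : F.graph.Connected := h.1.1

theorem IsCyclicForest.eq_of_vert_eq (h : F.IsCyclicForest p) {x y : D} (hx : x ∈ F.rootFace)
    (hy : y ∈ F.rootFace) (hxy : F.vert x = F.vert y) : x = y := h.2.2.1 x y hx hy hxy

theorem IsCyclicForest.exists_notMem (h : F.IsCyclicForest p) : ∃ x, x ∉ F.rootFace := by
  by_contra! hall
  have : Subsingleton F.Face := by
    refine ⟨fun a b => ?_⟩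
    obtain ⟨x, rfl⟩ := Quotient.exists_rep a
    obtain ⟨y, rfl⟩ := Quotient.exists_rep b
    exact (hall x).trans (hall y).symm
  have h2 := h.2.1
  have := Finite.card_le_one_iff_subsingleton (α := F.Face) |>.2 this
  omega

theorem ξ_succ (i : ℕ) : F.ξ (i + 1) = F.φ (F.ξ i) := by
  rw [ξ, pow_succ', Equiv.Perm.mul_apply]; rfl

theorem ξ_eq_iterate (i : ℕ) : F.ξ i = F.φ^[i] (F.σ F.root) := by
  rw [ξ, Equiv.Perm.iterate_eq_pow]

theorem ξ_add_N (i : ℕ) : F.ξ (i + F.N) = F.ξ i := by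
  rw [ξ_eq_iterate, ξ_eq_iterate, N, Function.iterate_add_minimalPeriod_eq]

theorem ξ_mod_N (i : ℕ) : F.ξ (i % F.N) = F.ξ i := by
  rw [ξ_eq_iterate, ξ_eq_iterate, N, Function.iterate_mod_minimalPeriod_eq]

theorem ξ_inj_of_lt {i j : ℕ} (hi : i < F.N) (hj : j < F.N) (h : F.ξ i = F.ξ j) : i = j := by
  rw [ξ_eq_iterate, ξ_eq_iterate] at h
  exact (Function.iterate_eq_iterate_iff_of_lt_minimalPeriod hi hj).1 h

variable [Finite D]

/-- If both sides of an edge were on the root face, simplicity of the boundary would make the two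
darts stable under `σ` and `α`. By connectedness they would be the whole map, leaving no dart for
the second face. -/
theorem IsCyclicForest.α_notMem (h : F.IsCyclicForest p) {x : D} (hx : x ∈ F.rootFace) :
    F.α x ∉ F.rootFace := by
  intro hα
  have h1 : F.φ x = F.α x := h.eq_of_vert_eq (by simpa using hx) hα (F.vert_φ x)
  have h2 : F.φ (F.α x) = x :=
    h.eq_of_vert_eq (by simpa using hα) hx (by rw [F.vert_φ, F.α_invol])
  obtain ⟨y, hy⟩ := h.exists_notMem
  have := F.connected_induction h.connected (S := {x, F.α x}) ⟨x, by simp⟩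
    (by
      rintro z (rfl | rfl)
      · rw [φ_α] at h2; simp [h2]
      · rw [φ_apply] at h1; simp [h1])
    (by rintro z (rfl | rfl) <;> simp [F.α_invol]) y
  obtain rfl | rfl := this <;> contradiction

theorem IsCyclicForest.σ_notMem (h : F.IsCyclicForest p) {x : D} (hx : x ∈ F.rootFace) :
    F.σ x ∉ F.rootFace := by
  intro hs
  rw [← φ_α, φ_mem_rootFace] at hs
  exact h.α_notMem hx hs

theorem IsCyclicForest.not_isBlossom (h : F.IsCyclicForest p) {x : D} (hx : x ∈ F.rootFace) :
    ¬ F.IsBlossom x := by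
  intro hb
  apply h.σ_notMem hx
  rwa [hb]

theorem IsCyclicForest.not_isBlossom_α (h : F.IsCyclicForest p) {x : D} (hx : x ∈ F.rootFace) :
    ¬ F.IsBlossom (F.α x) := by
  rw [← isBlossom_φ]
  exact h.not_isBlossom (by simpa using hx)

theorem IsCyclicForest.not_onRootFace (h : F.IsCyclicForest p) {b : D} (hb : F.IsBlossom b) :
    ¬ F.OnRootFace b := by
  rintro ⟨y, hy, hv⟩
  rw [F.eq_of_vert_eq_of_isBlossom hb hv.symm] at hy
  exact h.not_isBlossom hy hb

theorem IsCyclicForest.not_isBlossom_α_of_isBlossom (h : F.IsCyclicForest p) {b : D}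
    (hb : F.IsBlossom b) : ¬ F.IsBlossom (F.α b) := by
  intro hb'
  have := F.connected_induction h.connected (S := {b, F.α b}) ⟨b, by simp⟩
    (by
      rintro z (rfl | rfl)
      · simp [show F.σ z = z from hb]
      · simp [show F.σ (F.α b) = F.α b from hb'])
    (by rintro z (rfl | rfl) <;> simp [F.α_invol]) F.root
  obtain h1 | h1 := this
  · exact h.not_isBlossom (h1 ▸ F.root_mem) hb
  · exact h.not_isBlossom (h1 ▸ F.root_mem) hb'

theorem IsCyclicForest.face_eq (h : F.IsCyclicForest p) {x y : D} (hx : x ∉ F.rootFace)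
    (hy : y ∉ F.rootFace) : F.face x = F.face y := by
  by_contra hne
  have h2 := h.2.1
  have : Finite F.Face := Quotient.finite _
  have : Fintype F.Face := Fintype.ofFinite _
  classical
  have h3 : ({F.face F.root, F.face x, F.face y} : Finset F.Face).card ≤ Fintype.card F.Face :=
    Finset.card_le_univ _
  rw [Finset.card_eq_three.2 ⟨_, _, _, fun e => hx e.symm, fun e => hy e.symm, hne, rfl⟩,
    ← Nat.card_eq_fintype_card] at h3
  omega

theorem IsCyclicForest.ξ_notMem (h : F.IsCyclicForest p) (i : ℕ) : F.ξ i ∉ F.rootFace := by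
  induction i with
  | zero => exact h.σ_notMem F.root_mem
  | succ i ih => rwa [ξ_succ, φ_mem_rootFace]

theorem N_pos (F : PlaneMap D) : 0 < F.N := by
  rw [N, Function.minimalPeriod_pos_iff_mem_periodicPts]
  exact Function.Injective.mem_periodicPts F.φ.injective _

theorem ξ_eq_iff {i j : ℕ} : F.ξ i = F.ξ j ↔ i % F.N = j % F.N := by
  constructor
  · intro h
    rw [← ξ_mod_N i, ← ξ_mod_N j] at h
    exact ξ_inj_of_lt (Nat.mod_lt _ F.N_pos) (Nat.mod_lt _ F.N_pos) h
  · intro h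
    rw [← ξ_mod_N i, ← ξ_mod_N j, h]

theorem IsCyclicForest.exists_ξ (h : F.IsCyclicForest p) {x : D} (hx : x ∉ F.rootFace) :
    ∃ i < F.N, F.ξ i = x := by
  have h1 := h.face_eq (h.σ_notMem F.root_mem) hx
  obtain ⟨n, hn⟩ := (F.face_eq_iff.1 h1).exists_nat_pow_eq
  exact ⟨n % F.N, Nat.mod_lt _ F.N_pos, by rw [ξ_mod_N]; exact hn⟩

theorem IsCyclicForest.pos_lt (h : F.IsCyclicForest p) {x : D} (hx : x ∉ F.rootFace) :
    F.pos x < F.N := by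
  obtain ⟨i, hi, hx⟩ := h.exists_ξ hx
  exact (Nat.sInf_le (show i ∈ {i | F.ξ i = x} from hx)).trans_lt hi

theorem IsCyclicForest.ξ_pos (h : F.IsCyclicForest p) {x : D} (hx : x ∉ F.rootFace) :
    F.ξ (F.pos x) = x := by
  obtain ⟨i, hi, hx⟩ := h.exists_ξ hx
  exact Nat.sInf_mem (s := {i | F.ξ i = x}) ⟨i, hx⟩

end Forest

end PlaneMap

/-! ### Parent darts, counting of blossoms, and the label drop over one turn. -/

namespace PlaneMap

variable {D : Type*} {F : PlaneMap D} {p : ℕ}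

/-- `P` contains one dart at each vertex that is not on the root face, so that each edge that
is not on the root face has one dart in `P`, and following the darts of `P` decreases `r`. -/
structure IsParentSet (F : PlaneMap D) (P : Set D) (r : D → ℕ) : Prop where
  exists_vert_eq : ∀ x, ¬ F.OnRootFace x → ∃ d ∈ P, F.vert d = F.vert x
  eq_of_vert_eq : ∀ d ∈ P, ∀ d' ∈ P, F.vert d = F.vert d' → d = d'
  not_onRootFace : ∀ d ∈ P, ¬ F.OnRootFace d
  mem_iff : ∀ d, d ∉ F.rootFace → F.α d ∉ F.rootFace → (d ∈ P ↔ F.α d ∉ P)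
  lt : ∀ d ∈ P, r (F.α d) < r d
  rank_σ : ∀ d, r (F.σ d) = r d
  card : Nat.card D = 2 * P.ncard + 2 * F.rootFace.ncard

theorem two_mul_card_edge [Finite D] (F : PlaneMap D) : Nat.card D = 2 * Nat.card F.Edge := by
  classical
  have : Fintype D := Fintype.ofFinite _
  have : Finite F.Edge := Quotient.finite _
  have : Fintype F.Edge := Fintype.ofFinite _
  let mk : D → F.Edge := Quotient.mk (Equiv.Perm.SameCycle.setoid F.α)
  have hmk : ∀ x y, mk x = mk y ↔ (x = y ∨ x = F.α y) := by
    intro x y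
    have h0 : mk x = mk y ↔ F.α.SameCycle x y := Quotient.eq
    rw [h0]
    constructor
    · intro h
      exact h.symm.mem_of_mapsTo (S := {z | z = y ∨ z = F.α y})
        (by rintro z (rfl | rfl) <;> simp [F.α_invol]) (Or.inl rfl)
    · rintro (rfl | rfl)
      · exact Equiv.Perm.SameCycle.refl _ _
      · exact Equiv.Perm.sameCycle_apply_left.2 (Equiv.Perm.SameCycle.refl _ _)
  rw [Nat.card_eq_fintype_card, Nat.card_eq_fintype_card, ← Finset.card_univ,
    Finset.card_eq_sum_card_fiberwise (f := mk) (t := Finset.univ) (by simp [Set.MapsTo])]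
  rw [Finset.sum_const_nat (m := 2), mul_comm, Finset.card_univ]
  intro e _
  obtain ⟨y, rfl⟩ := Quotient.exists_rep e
  rw [Finset.card_eq_two]
  refine ⟨y, F.α y, (F.α_ne y).symm, ?_⟩
  ext x
  simpa using hmk x y

theorem exists_dart_dist_lt (hc : F.graph.Connected) {v : F.Vertex} (hv : v ≠ F.vert F.root) :
    ∃ d, F.vert d = v ∧ F.graph.dist (F.vert (F.α d)) (F.vert F.root) <
      F.graph.dist v (F.vert F.root) := by
  obtain ⟨w, hw⟩ := (hc.preconnected v (F.vert F.root)).exists_walk_length_eq_dist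
  cases w with
  | nil => exact absurd rfl hv
  | @cons _ u _ hadj w =>
    have h1 : F.graph.dist u (F.vert F.root) < F.graph.dist v (F.vert F.root) := by
      rw [← hw, SimpleGraph.Walk.length_cons]
      exact Nat.lt_succ_of_le (SimpleGraph.dist_le w)
    rw [graph, SimpleGraph.fromRel_adj] at hadj
    obtain ⟨-, ⟨d, rfl, rfl⟩ | ⟨d, rfl, rfl⟩⟩ := hadj
    · exact ⟨d, rfl, h1⟩
    · exact ⟨F.α d, rfl, by rwa [F.α_invol]⟩

/-- Each vertex off the root face chooses a dart that brings it closer to the root vertex. With the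
darts of the root face this makes one dart per vertex, on distinct edges. Euler's formula with two
faces says that there are as many vertices as edges, so every edge is used. -/
theorem IsCyclicForest.exists_isParentSet [Finite D] (h : F.IsCyclicForest p) :
    ∃ P r, F.IsParentSet P r := by
  classical
  have hpar : ∀ v : F.Vertex, ∃ d, v ≠ F.vert F.root → F.vert d = v ∧
      F.graph.dist (F.vert (F.α d)) (F.vert F.root) < F.graph.dist v (F.vert F.root) := by
    intro v
    by_cases hv : v = F.vert F.root
    · exact ⟨F.root, fun h => absurd hv h⟩
    · obtain ⟨d, hd⟩ := exists_dart_dist_lt h.connected hv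
      exact ⟨d, fun _ => hd⟩
  choose par hpar using hpar
  have hne : ∀ x, ¬ F.OnRootFace x → F.vert x ≠ F.vert F.root := fun x hx hv =>
    hx ((onRootFace_congr F hv).2 (F.onRootFace_of_mem F.root_mem))
  let P : Set D := {d | ¬ F.OnRootFace d ∧ par (F.vert d) = d}
  let r : D → ℕ := fun d => F.graph.dist (F.vert d) (F.vert F.root)
  have hex : ∀ x, ¬ F.OnRootFace x → ∃ d ∈ P, F.vert d = F.vert x := by
    intro x hx
    obtain ⟨h1, h2⟩ := hpar _ (hne x hx)
    exact ⟨par (F.vert x), ⟨fun h => hx ((onRootFace_congr F h1).1 h), by rw [h1]⟩, h1⟩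
  have hinj : ∀ d ∈ P, ∀ d' ∈ P, F.vert d = F.vert d' → d = d' := by
    rintro d ⟨-, hd⟩ d' ⟨-, hd'⟩ hv
    rw [← hd, ← hd', hv]
  have hlt : ∀ d ∈ P, r (F.α d) < r d := by
    rintro d ⟨hd, hd'⟩
    have := (hpar _ (hne d hd)).2
    rwa [hd'] at this
  have hPR : ∀ d ∈ P, d ∉ F.rootFace ∧ F.α d ∉ F.rootFace := fun d hd =>
    ⟨fun h => hd.1 (F.onRootFace_of_mem h), fun h => hd.1 (by
      have := F.onRootFace_α h
      rwa [F.α_invol] at this)⟩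
  let A : Set D := P ∪ F.rootFace
  have hdisj : Disjoint A (F.α '' A) := by
    rw [Set.disjoint_left]
    rintro _ hd ⟨d, hd', rfl⟩
    rcases hd' with hd' | hd' <;> rcases hd with hd | hd
    · have h1 := hlt _ hd
      have h2 := hlt _ hd'
      rw [F.α_invol] at h1
      omega
    · exact (hPR _ hd').2 hd
    · have := (hPR _ hd).2
      rw [F.α_invol] at this
      exact this hd'
    · exact h.α_notMem hd' hd
  have hA : A.ncard = Nat.card F.Vertex := by
    rw [← Set.ncard_univ, ← Set.InjOn.ncard_image (f := F.vert) (s := A)]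
    · congr 1
      ext v
      simp only [Set.mem_image, Set.mem_univ, iff_true]
      obtain ⟨x, rfl⟩ := F.vert_surj v
      by_cases hx : F.OnRootFace x
      · obtain ⟨y, hy, hv⟩ := hx
        exact ⟨y, Or.inr hy, hv⟩
      · obtain ⟨d, hd, hv⟩ := hex x hx
        exact ⟨d, Or.inl hd, hv⟩
    · rintro x (hx | hx) y (hy | hy) hv
      · exact hinj x hx y hy hv
      · exact absurd ((onRootFace_congr F hv).2 (F.onRootFace_of_mem hy)) hx.1
      · exact absurd ((onRootFace_congr F hv).1 (F.onRootFace_of_mem hx)) hy.1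
      · exact h.eq_of_vert_eq hx hy hv
  have hAP : A.ncard = P.ncard + F.rootFace.ncard := by
    refine Set.ncard_union_eq ?_
    rw [Set.disjoint_left]
    exact fun d hd => (hPR d hd).1
  have hcard : (A ∪ F.α '' A).ncard = Nat.card D := by
    rw [Set.ncard_union_eq hdisj, Set.ncard_image_of_injective _ F.α.injective, hA,
      two_mul_card_edge F]
    have h1 := h.1.2
    have h2 := h.2.1
    omega
  have huniv : A ∪ F.α '' A = Set.univ := by
    apply Set.eq_of_subset_of_ncard_le (Set.subset_univ _)
    rw [hcard, Set.ncard_univ]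
  refine ⟨P, r, hex, hinj, fun d hd => hd.1, ?_, hlt, fun d => by simp [r], ?_⟩
  · intro d hd hd'
    constructor
    · intro hP hP'
      exact Set.disjoint_left.1 hdisj (Or.inl hP') ⟨d, Or.inl hP, rfl⟩
    · intro hP
      have : d ∈ A ∪ F.α '' A := huniv ▸ Set.mem_univ d
      rcases this with (h1 | h1) | ⟨y, h1 | h1, rfl⟩
      · exact h1
      · exact absurd h1 hd
      · rw [F.α_invol] at hP
        exact absurd h1 hP
      · rw [F.α_invol] at hd'
        exact absurd h1 hd'
  · rw [← hcard, Set.ncard_union_eq hdisj, Set.ncard_image_of_injective _ F.α.injective, hAP]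
    ring

theorem IsParentSet.mem_of_isBlossom [Finite D] (h : F.IsCyclicForest p) {P : Set D} {r : D → ℕ}
    (hP : F.IsParentSet P r) {b : D} (hb : F.IsBlossom b) : b ∈ P := by
  obtain ⟨d, hd, hv⟩ := hP.exists_vert_eq b (h.not_onRootFace hb)
  rwa [F.eq_of_vert_eq_of_isBlossom hb hv.symm] at hd

theorem IsBlossomingForest.isCyclicForest (h : F.IsBlossomingForest p) : F.IsCyclicForest p := h.2.1

/-- Let `B` be the number of blossoms and `n` the number of other vertices off the root face. Parent
darts give `|D| = 2(B + n) + 2p`, and counting blossoms by their neighbours gives `B = (p - 3) +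
2n`. Eliminate `n`. -/
theorem IsBlossomingForest.three_mul_card_blossom [Finite D] (h : F.IsBlossomingForest p) :
    3 * {b | F.IsBlossom b}.ncard + p + 3 = Nat.card D := by
  classical
  have : Fintype D := Fintype.ofFinite _
  have hc := h.isCyclicForest
  obtain ⟨P, r, hP⟩ := hc.exists_isParentSet
  have hcard := hP.card
  have hp : F.rootFace.ncard = p := hc.2.2.2
  have h3 := h.2.2.2
  let P' : Set D := {d | d ∈ P ∧ ¬ F.IsBlossom d}
  have hPc : P.ncard = {b | F.IsBlossom b}.ncard + P'.ncard := by
    rw [← Set.ncard_union_eq]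
    · congr 1
      ext d
      by_cases hd : F.IsBlossom d
      · simp [P', hd, hP.mem_of_isBlossom hc hd]
      · simp [P', hd]
    · rw [Set.disjoint_left]
      exact fun d hd hd' => hd'.2 hd
  let S₀ : Set D := {b | F.IsBlossom b ∧ F.OnRootFace (F.α b)}
  let S₁ : Set D := {b | F.IsBlossom b ∧ ¬ F.OnRootFace (F.α b)}
  have hB : {b | F.IsBlossom b}.ncard = S₀.ncard + S₁.ncard := by
    rw [← Set.ncard_union_eq]
    · congr 1
      ext d
      simp only [S₀, S₁, Set.mem_ofPred_eq, Set.mem_union]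
      tauto
    · rw [Set.disjoint_left]
      exact fun d hd hd' => hd'.2 hd.2
  have hS : S₁.ncard = 2 * P'.ncard := by
    have hg : ∀ x, ∃ d, ¬ F.OnRootFace x → d ∈ P ∧ F.vert d = F.vert x := by
      intro x
      by_cases hx : F.OnRootFace x
      · exact ⟨x, fun h => absurd hx h⟩
      · obtain ⟨d, hd⟩ := hP.exists_vert_eq x hx
        exact ⟨d, fun _ => hd⟩
    choose g hg using hg
    rw [Set.ncard_eq_toFinset_card', Set.ncard_eq_toFinset_card',
      Finset.card_eq_sum_card_fiberwise (f := fun b => g (F.α b)) (t := P'.toFinset),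
      Finset.sum_const_nat (m := 2), mul_comm]
    · intro d hd
      rw [Set.mem_toFinset] at hd
      rw [← h.2.2.1 d (hP.not_onRootFace d hd.1) hd.2, ← Set.ncard_image_of_injective _ F.α.injective,
        ← Set.ncard_coe_finset]
      congr 1
      ext b
      simp only [Finset.coe_filter, Set.mem_toFinset, Set.mem_ofPred_eq, S₁, Set.mem_image]
      constructor
      · rintro ⟨⟨hb, hb'⟩, hbd⟩
        refine ⟨F.α b, ⟨?_, by rwa [F.α_invol]⟩, F.α_invol _⟩
        rw [← hbd, (hg _ hb').2]
      · rintro ⟨x, ⟨hx, hx'⟩, rfl⟩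
        have h1 : ¬ F.OnRootFace x := fun h =>
          hP.not_onRootFace d hd.1 ((onRootFace_congr F hx).1 h)
        rw [F.α_invol]
        exact ⟨⟨hx', h1⟩, hP.eq_of_vert_eq _ (hg _ h1).1 _ hd.1 ((hg _ h1).2.trans hx)⟩
    · intro b hb
      simp only [Set.coe_toFinset, S₁, Set.mem_ofPred_eq, P'] at hb ⊢
      obtain ⟨h1, h2⟩ := hg _ hb.2
      refine ⟨h1, fun hbl => ?_⟩
      rw [← F.eq_of_vert_eq_of_isBlossom hbl h2] at hbl
      exact hc.not_isBlossom_α_of_isBlossom hb.1 hbl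
  have : S₀.ncard + 3 = p := h3
  omega

open Classical in
/-- The increment of the labels along the contour. -/
noncomputable def incr (F : PlaneMap D) (d : D) : ℤ :=
  if F.IsBlossom d then 1 else if F.IsBlossom (F.α d) then 0 else -1

theorem lam_zero : F.lam 0 = 0 := rfl

theorem lam_succ (i : ℕ) : F.lam (i + 1) = F.lam i + F.incr (F.ξ i) := by
  rw [lam, incr, ξ_succ, isBlossom_φ]
  split_ifs <;> ring

theorem lam_add_N (i : ℕ) : F.lam (i + F.N) = F.lam i + F.lam F.N := by
  induction i with
  | zero => simp [lam_zero]
  | succ i ih =>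
    rw [show i + 1 + F.N = i + F.N + 1 by ring, lam_succ, lam_succ, ih, ξ_add_N]; ring

/-- Summed over all darts the increments give `3B - |D| = -p - 3`, with `B` the number of blossoms.
The `p` darts of the root face, which are not in the contour, account for `-p`. -/
theorem IsBlossomingForest.lam_N [Finite D] (h : F.IsBlossomingForest p) : F.lam F.N = -3 := by
  classical
  have : Fintype D := Fintype.ofFinite _
  have hc := h.isCyclicForest
  have h1 : ∀ n, F.lam n = ∑ i ∈ Finset.range n, F.incr (F.ξ i) := by
    intro n
    induction n with
    | zero => rfl
    | succ n ih => rw [Finset.sum_range_succ, lam_succ, ih]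
  have h2 : F.lam F.N = ∑ d with d ∉ F.rootFace, F.incr d := by
    rw [h1]
    refine Finset.sum_nbij F.ξ ?_ ?_ ?_ fun _ _ => rfl
    · intro i _
      simpa using hc.ξ_notMem i
    · intro i hi j hj hij
      exact ξ_inj_of_lt (by simpa using hi) (by simpa using hj) hij
    · intro d hd
      obtain ⟨i, hi, hd⟩ := hc.exists_ξ (by simpa using hd)
      exact ⟨i, by simpa using hi, hd⟩
  have h3 : ∑ d, F.incr d = 3 * {b | F.IsBlossom b}.ncard - Nat.card D := by
    have : ∀ d, F.incr d = 2 * (if F.IsBlossom d then 1 else 0)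
        + (if F.IsBlossom (F.α d) then 1 else 0) - 1 := by
      intro d
      rw [incr]
      by_cases hd : F.IsBlossom d
      · simp [hd, hc.not_isBlossom_α_of_isBlossom hd]
      · by_cases hd' : F.IsBlossom (F.α d) <;> simp [hd, hd']
    simp_rw [this]
    rw [Finset.sum_sub_distrib, Finset.sum_add_distrib, ← Finset.mul_sum,
      Equiv.sum_comp F.α (fun d => if F.IsBlossom d then (1 : ℤ) else 0), Finset.sum_boole,
      Set.ncard_eq_toFinset_card', Nat.card_eq_fintype_card]
    simp
    ring
  have h4 : ∑ d with d ∈ F.rootFace, F.incr d = -p := by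
    rw [Finset.sum_congr rfl (g := fun _ => (-1 : ℤ))]
    · have hR : ({d | d ∈ F.rootFace} : Finset D).card = p := by
        rw [← Set.ncard_coe_finset, Finset.coe_filter_univ]
        exact hc.2.2.2
      rw [Finset.sum_const, hR]
      simp
    · intro d hd
      have hd : d ∈ F.rootFace := by simpa using hd
      rw [incr, if_neg (hc.not_isBlossom hd), if_neg (hc.not_isBlossom_α hd)]
  have h5 := Finset.sum_filter_add_sum_filter_not Finset.univ (· ∈ F.rootFace) F.incr
  have h6 := h.three_mul_card_blossom
  rw [h3, h4, ← h2] at h5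
  omega

end PlaneMap

/-! ### Effect of one local closure on vertices, blossoms and the marked face. -/

namespace MarkedMap

variable {D : Type*}

/-- The darts on the boundary of the marked face. -/
def markedFace (G : MarkedMap D) : Set D := {x | G.face x = G.face G.mark}

theorem mem_markedFace {G : MarkedMap D} {x : D} : x ∈ G.markedFace ↔ G.face x = G.face G.mark :=
  Iff.rfl

@[simp] theorem φ_mem_markedFace {G : MarkedMap D} {x : D} :
    G.φ x ∈ G.markedFace ↔ x ∈ G.markedFace := by simp [mem_markedFace]

theorem mark_mem (G : MarkedMap D) : G.mark ∈ G.markedFace := rfl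

theorem markedFace_subset [Finite D] {G : MarkedMap D} {x : D} (hx : x ∈ G.markedFace) {S : Set D}
    (hS : ∀ y ∈ S, G.φ y ∈ S) (hxS : x ∈ S) : G.markedFace ⊆ S := by
  intro y hy
  exact (G.face_eq_iff.1 (hx.trans (Eq.symm hy))).mem_of_mapsTo hS hxS

/-- The stem of the blossom `b` is followed by two proper edges. -/
structure CanClose (G : MarkedMap D) (b : D) : Prop where
  blossom : G.IsBlossom b
  proper₁ : G.IsProper (G.φ b)
  proper₂ : G.IsProper (G.φ (G.φ b))

/-- The boundary of the face that a local closure creates. -/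
def triangle (G : MarkedMap D) (b : D) : Set D := {b, G.φ b, G.φ (G.φ b)}

/-- The dart before which a local closure inserts the dart `b`. -/
def target (G : MarkedMap D) (b : D) : D := G.φ (G.φ (G.φ b))

theorem close_α [DecidableEq D] (G : MarkedMap D) (b : D) : (G.close b).α = G.α := rfl

theorem close_σ [DecidableEq D] (G : MarkedMap D) (b x : D) :
    (G.close b).σ x = Equiv.swap b (G.target b) (G.σ x) := rfl

theorem close_φ [DecidableEq D] (G : MarkedMap D) (b x : D) :
    (G.close b).φ x = Equiv.swap b (G.target b) (G.φ x) := rfl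

theorem LocalClosure.exists_canClose [DecidableEq D] {G G' : MarkedMap D} (h : LocalClosure G G') :
    ∃ b, G.CanClose b ∧ G' = G.close b := by
  obtain ⟨b, h1, h2, h3, rfl⟩ := h
  exact ⟨b, ⟨h1, h2, h3⟩, rfl⟩

namespace CanClose

variable {G : MarkedMap D} {b : D}

theorem φ_α (h : G.CanClose b) : G.φ (G.α b) = b := by
  rw [PlaneMap.φ_α]; exact h.blossom

theorem not_blossom_target (h : G.CanClose b) : ¬ G.IsBlossom (G.target b) := by
  rw [target, PlaneMap.isBlossom_φ]; exact h.proper₂.2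

theorem target_ne (h : G.CanClose b) : G.target b ≠ b := fun e =>
  h.not_blossom_target (by rw [e]; exact h.blossom)

theorem φ_ne (h : G.CanClose b) : G.φ b ≠ b := fun e =>
  h.proper₁.1 (by rw [e]; exact h.blossom)

theorem φ_φ_ne (h : G.CanClose b) : G.φ (G.φ b) ≠ b := fun e =>
  h.proper₂.1 (by rw [e]; exact h.blossom)

theorem target_notMem (h : G.CanClose b) : G.target b ∉ G.triangle b := by
  rintro (e | e | e)
  · exact h.target_ne e
  · exact h.φ_φ_ne (G.φ.injective e)
  · exact h.φ_ne (G.φ.injective (G.φ.injective e))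

theorem α_notMem (h : G.CanClose b) : G.α b ∉ G.triangle b := by
  rintro (e | e | e)
  · exact G.α_ne _ e
  · exact h.proper₁.2 (by rw [← e, G.α_invol]; exact h.blossom)
  · exact h.proper₂.2 (by rw [← e, G.α_invol]; exact h.blossom)

theorem α_mem_markedFace (h : G.CanClose b) (hb : b ∈ G.markedFace) : G.α b ∈ G.markedFace := by
  rwa [← φ_mem_markedFace, h.φ_α]

theorem blossom_notMem_triangle (h : G.CanClose b) {x : D} (hx : G.IsBlossom x) (hxb : x ≠ b) :
    x ∉ G.triangle b := by
  rintro (e | e | e)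
  · exact hxb e
  · exact h.proper₁.1 (e ▸ hx)
  · exact h.proper₂.1 (e ▸ hx)

variable [DecidableEq D]

theorem close_σ_self (h : G.CanClose b) : (G.close b).σ b = G.target b := by
  rw [close_σ, show G.σ b = b from h.blossom, Equiv.swap_apply_left]

theorem close_σ_of_ne (h : G.CanClose b) {x : D} (hx : x ≠ b) (hx' : G.σ x ≠ G.target b) :
    (G.close b).σ x = G.σ x := by
  rw [close_σ, Equiv.swap_apply_of_ne_of_ne _ hx']
  intro e
  rw [← show G.σ b = b from h.blossom] at e
  exact hx (G.σ.injective e)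

theorem close_σ_of_eq {x : D} (hx : G.σ x = G.target b) : (G.close b).σ x = b := by
  rw [close_σ, hx, Equiv.swap_apply_right]

theorem close_φ_α (h : G.CanClose b) : (G.close b).φ (G.α b) = G.target b := by
  rw [close_φ, h.φ_α, Equiv.swap_apply_left]

theorem close_φ_last : (G.close b).φ (G.φ (G.φ b)) = b := by
  rw [close_φ]; exact Equiv.swap_apply_right _ _

theorem close_φ_of_ne (h : G.CanClose b) {x : D} (hx : x ≠ G.α b) (hx' : x ≠ G.φ (G.φ b)) :
    (G.close b).φ x = G.φ x := by
  rw [close_φ, Equiv.swap_apply_of_ne_of_ne]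
  · exact fun e => hx (G.φ.injective (e.trans h.φ_α.symm))
  · exact fun e => hx' (G.φ.injective e)

theorem isBlossom_close (h : G.CanClose b) {x : D} :
    (G.close b).IsBlossom x ↔ G.IsBlossom x ∧ x ≠ b := by
  unfold PlaneMap.IsBlossom
  by_cases hx : x = b
  · subst hx
    simp [h.close_σ_self, h.target_ne]
  by_cases hx' : G.σ x = G.target b
  · rw [close_σ_of_eq hx']
    refine ⟨fun e => absurd e.symm hx, fun e => absurd ?_ h.not_blossom_target⟩
    rw [← hx', PlaneMap.isBlossom_σ]; exact e.1
  · rw [h.close_σ_of_ne hx hx']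
    simp [hx]

/-- The closure cuts the triangle off the marked face. Each inclusion comes from a set stable under
the relevant `φ`, which therefore contains the whole marked face. -/
theorem mem_markedFace_close [Finite D] (h : G.CanClose b) (hb : b ∈ G.markedFace) {x : D} :
    x ∈ (G.close b).markedFace ↔ x ∈ G.markedFace ∧ x ∉ G.triangle b := by
  constructor
  · intro hx
    refine markedFace_subset (G := G.close b) (S := {x | x ∈ G.markedFace ∧ x ∉ G.triangle b})
      (mark_mem _) ?_ ⟨h.α_mem_markedFace hb, h.α_notMem⟩ hx
    rintro y ⟨hy, hyT⟩
    by_cases hya : y = G.α b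
    · rw [hya, h.close_φ_α]
      exact ⟨by simpa [target] using hb, h.target_notMem⟩
    · rw [h.close_φ_of_ne hya (fun e => hyT (Or.inr (Or.inr e)))]
      refine ⟨by simpa using hy, ?_⟩
      rintro (e | e | e)
      · exact hya (G.φ.injective (e.trans h.φ_α.symm))
      · exact hyT (Or.inl (G.φ.injective e))
      · exact hyT (Or.inr (Or.inl (G.φ.injective e)))
  · rintro ⟨hx, hxT⟩
    refine (markedFace_subset (S := {x | x ∈ (G.close b).markedFace ∨ x ∈ G.triangle b})
      (h.α_mem_markedFace hb) ?_ (Or.inl (mark_mem (G.close b))) hx).resolve_right hxT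
    have ht : G.target b ∈ (G.close b).markedFace := by
      rw [← h.close_φ_α, φ_mem_markedFace]; exact mark_mem (G.close b)
    rintro y (hy | rfl | rfl | rfl)
    · by_cases hya : y = G.α b
      · right
        rw [hya, h.φ_α]; exact Or.inl rfl
      · by_cases hyb : y = G.φ (G.φ b)
        · left; rw [hyb]; exact ht
        · left
          rw [← h.close_φ_of_ne hya hyb]; simpa using hy
    · exact Or.inr (Or.inr (Or.inl rfl))
    · exact Or.inr (Or.inr (Or.inr rfl))
    · exact Or.inl ht

end CanClose

end MarkedMap

/-! ### Invariants of partial closures. -/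

/-- `NextDart F s y z`: the dart `z` is the first of `s y, s (s y), …` that does not start at a
blossom of `F`. -/
inductive PlaneMap.NextDart {D : Type*} (F : PlaneMap D) (s : Equiv.Perm D) : D → D → Prop
  | base {y : D} : ¬ F.IsBlossom (s y) → NextDart F s y (s y)
  | step {y z : D} : F.IsBlossom (s y) → NextDart F s (s y) z → NextDart F s y z

/-- The position `t'` is the first one after `t` with a smaller label, and its label is
smaller by one. -/
def PlaneMap.IsSucc (F : PlaneMap D) (t t' : ℕ) : Prop :=
  t < t' ∧ F.lam t' = F.lam t - 1 ∧ ∀ s, t < s → s < t' → F.lam t ≤ F.lam s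

namespace MarkedMap

open PlaneMap

variable {D : Type*}

/-- Properties of the maps obtained in the course of the closure of `F`. -/
structure IsPartialClosure (F : PlaneMap D) (G : MarkedMap D) : Prop where
  α_eq : G.α = F.α
  root_eq : G.root = F.root
  φ_root : ∀ x ∈ F.rootFace, G.φ x = F.φ x
  exists_ξ : ∀ x ∈ G.markedFace, ∃ t, F.ξ t = x
  -- Positions are not reduced modulo `N`, so the contour of the marked face always moves forward.
  -- Remaining stems are followed as in `F`; every other edge, closed stems included, leads to the
  -- first later corner with a smaller label.
  step : ∀ t, F.ξ t ∈ G.markedFace → ∃ t', t < t' ∧ G.φ (F.ξ t) = F.ξ t' ∧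
    (G.IsBlossom (F.ξ t) → t' = t + 1) ∧ (G.IsBlossom (F.α (F.ξ t)) → t' = t + 1) ∧
    (¬ G.IsBlossom (F.ξ t) → ¬ G.IsBlossom (F.α (F.ξ t)) → F.IsSucc t t')
  isBlossom_iff : ∀ x, G.IsBlossom x ↔ F.IsBlossom x ∧ x ∈ G.markedFace
  nextDart : ∀ y, ¬ F.IsBlossom y → F.NextDart G.σ y (F.σ y)
  nextDart_blossom : ∀ t, F.IsBlossom (F.α (F.ξ t)) → ¬ G.IsBlossom (F.α (F.ξ t)) →
    ∃ t', F.NextDart G.σ (F.α (F.ξ t)) (F.ξ t') ∧ F.IsSucc t t'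

theorem isPartialClosure_self [Finite D] {F : PlaneMap D} {p : ℕ} (hF : F.IsCyclicForest p) :
    IsPartialClosure F ⟨F, F.σ F.root⟩ := by
  have hmem : ∀ x, x ∈ (MarkedMap.mk F (F.σ F.root)).markedFace ↔ x ∉ F.rootFace := by
    intro x
    constructor
    · intro hx hx'
      exact hF.σ_notMem F.root_mem ((Eq.symm hx).trans hx')
    · exact fun hx => hF.face_eq hx (hF.σ_notMem F.root_mem)
  refine ⟨rfl, rfl, fun _ _ => rfl, ?_, ?_, ?_, ?_, ?_⟩
  · intro x hx
    obtain ⟨t, -, ht⟩ := hF.exists_ξ ((hmem x).1 hx)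
    exact ⟨t, ht⟩
  · intro t _
    refine ⟨t + 1, by omega, (ξ_succ t).symm, fun _ => rfl, fun _ => rfl, fun h1 h2 =>
      ⟨by omega, ?_, fun s h h' => by omega⟩⟩
    rw [lam_succ, incr, if_neg h1, if_neg h2]; rfl
  · intro x
    rw [hmem]
    exact ⟨fun h => ⟨h, fun h' => hF.not_isBlossom h' h⟩, fun h => h.1⟩
  · intro y hy
    exact NextDart.base ((F.isBlossom_σ).not.2 hy)
  · intro t h1 h2
    exact absurd h1 h2

section

variable {F : PlaneMap D} {p : ℕ} {G : MarkedMap D} {b : D}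

/-- The only new dart in the rotation around the receiving vertex starts at a blossom of `F`, so it
is skipped. -/
theorem CanClose.nextDart_close [DecidableEq D] {s : D} (h : G.CanClose b) (hb : F.IsBlossom b)
    (ht : ¬ F.IsBlossom (G.target b)) {z : D} (hs : F.NextDart G.σ s z) (hsb : s ≠ b) :
    F.NextDart (G.close b).σ s z := by
  have hne : ∀ y, y ≠ b → G.σ y ≠ b := by
    intro y hy e
    rw [← show G.σ b = b from h.blossom] at e
    exact hy (G.σ.injective e)
  induction hs with
  | @base y hy =>
    by_cases hyt : G.σ y = G.target b
    · have h1 := CanClose.close_σ_of_eq hyt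
      apply NextDart.step
      · rw [h1]; exact hb
      · rw [h1, hyt]
        have := NextDart.base (F := F) (s := (G.close b).σ) (y := b)
        rw [h.close_σ_self] at this
        exact this ht
    · have h1 := h.close_σ_of_ne hsb hyt
      have := NextDart.base (F := F) (s := (G.close b).σ) (y := y)
      rw [h1] at this
      exact this hy
  | @step y z hy _ ih =>
    have h1 := h.close_σ_of_ne hsb (fun e => ht (e ▸ hy))
    apply NextDart.step
    · rw [h1]; exact hy
    · rw [h1]; exact ih (hne y hsb)

variable [Finite D]

/-- The contour of the marked face of `G` around the stem of `b`. -/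
theorem IsPartialClosure.isSucc_of_canClose (hF : F.IsCyclicForest p) (hG : IsPartialClosure F G)
    (h : G.CanClose b) {t : ℕ} (ht : F.ξ t = G.α b) :
    ∃ t', F.ξ t' = G.target b ∧ F.IsSucc t t' := by
  obtain ⟨hb, hbA⟩ := (hG.isBlossom_iff b).1 h.blossom
  obtain ⟨t₁, -, e₁, -, h₁, -⟩ := hG.step t (ht ▸ h.α_mem_markedFace hbA)
  have hα : F.α (F.ξ t) = b := by rw [ht, ← hG.α_eq, G.α_invol]
  rw [hα] at h₁
  have h₁ := h₁ h.blossom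
  subst h₁
  rw [ht, h.φ_α] at e₁
  obtain ⟨t₂, -, e₂, h₂, -, -⟩ := hG.step (t + 1) (e₁ ▸ hbA)
  rw [← e₁] at e₂ h₂
  have h₂ := h₂ h.blossom
  subst h₂
  obtain ⟨t₃, -, e₃, -, -, h₃⟩ := hG.step (t + 1 + 1) (e₂ ▸ by simpa using hbA)
  rw [← e₂, ← hG.α_eq] at h₃
  rw [← e₂] at e₃
  obtain ⟨l₃, l₃', l₃''⟩ := h₃ h.proper₁.1 h.proper₁.2
  obtain ⟨t₄, -, e₄, -, -, h₄⟩ := hG.step t₃ (e₃ ▸ by simpa using hbA)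
  rw [← e₃, ← hG.α_eq] at h₄
  rw [← e₃] at e₄
  obtain ⟨l₄, l₄', l₄''⟩ := h₄ h.proper₂.1 h.proper₂.2
  -- If `l` is the label at `t`, the corners met in turn at `u`, `b`, `u`, `v`, `w` have labels `l`,
  -- `l`, `l + 1`, `l`, `l - 1`. Hence `w` is the first place below `l`.
  have i₁ : F.lam (t + 1) = F.lam t := by
    rw [lam_succ, incr, ht, ← hG.α_eq, G.α_invol, if_neg, if_pos hb, add_zero]
    rw [hG.α_eq]
    exact hF.not_isBlossom_α_of_isBlossom hb
  have i₂ : F.lam (t + 1 + 1) = F.lam t + 1 := by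
    rw [lam_succ (t + 1), incr, ← e₁, if_pos hb, i₁]
  refine ⟨t₄, e₄.symm, by omega, by omega, fun s hs hs' => ?_⟩
  obtain rfl | hs := (show t + 1 ≤ s from hs).eq_or_lt
  · exact i₁.ge
  obtain rfl | hs := (show t + 1 + 1 ≤ s from hs).eq_or_lt
  · omega
  rcases lt_trichotomy s t₃ with h | rfl | h
  · have := l₃'' s hs h; omega
  · omega
  · have := l₄'' s h hs'; omega

variable [DecidableEq D]

theorem IsPartialClosure.close (hF : F.IsCyclicForest p) (hG : IsPartialClosure F G)
    (h : G.CanClose b) : IsPartialClosure F (G.close b) := by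
  obtain ⟨hb, hbA⟩ := (hG.isBlossom_iff b).1 h.blossom
  have hαR : G.α b ∉ F.rootFace := by
    intro hR
    have := hF.not_isBlossom_α hR
    rw [← hG.α_eq, G.α_invol] at this
    exact this hb
  have hA : ∀ x ∈ G.markedFace, x ∉ F.rootFace := by
    intro x hx
    obtain ⟨t, rfl⟩ := hG.exists_ξ x hx
    exact hF.ξ_notMem t
  have htA : G.target b ∈ G.markedFace := by simpa [target] using hbA
  have htF : ¬ F.IsBlossom (G.target b) := fun e =>
    h.not_blossom_target ((hG.isBlossom_iff _).2 ⟨e, htA⟩)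
  refine ⟨hG.α_eq, hG.root_eq, ?_, ?_, ?_, ?_, ?_, ?_⟩
  · intro x hx
    rw [h.close_φ_of_ne, hG.φ_root x hx]
    · rintro rfl
      exact hαR hx
    · rintro rfl
      exact hA (G.φ (G.φ b)) (by simpa using hbA) hx
  · intro x hx
    exact hG.exists_ξ x ((h.mem_markedFace_close hbA).1 hx).1
  · intro t ht
    obtain ⟨htA', htT⟩ := (h.mem_markedFace_close hbA).1 ht
    simp only [h.isBlossom_close]
    -- On what remains of the marked face, only `α b` gets a new successor.
    by_cases hta : F.ξ t = G.α b
    · obtain ⟨t', ht', hs⟩ := hG.isSucc_of_canClose hF h hta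
      refine ⟨t', hs.1, ?_, ?_, ?_, fun _ _ => hs⟩
      · rw [hta, h.close_φ_α, ht']
      · rintro ⟨h1, -⟩
        have := hF.not_isBlossom_α_of_isBlossom ((hG.isBlossom_iff _).1 h1).1
        rw [hta, ← hG.α_eq, G.α_invol] at this
        exact absurd hb this
      · rintro ⟨-, h1⟩
        rw [hta, ← hG.α_eq, G.α_invol] at h1
        exact absurd rfl h1
    · have h1 : F.ξ t ≠ b := fun e => htT (Or.inl e)
      have h2 : F.α (F.ξ t) ≠ b := by
        intro e
        rw [← e, ← hG.α_eq, G.α_invol] at hta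
        exact hta rfl
      simp only [h1, h2, ne_eq, not_false_eq_true, and_true]
      rw [h.close_φ_of_ne hta (fun e => htT (Or.inr (Or.inr e)))]
      exact hG.step t htA'
  · intro x
    rw [h.isBlossom_close, hG.isBlossom_iff, h.mem_markedFace_close hbA]
    constructor
    · rintro ⟨⟨h1, h2⟩, h3⟩
      exact ⟨h1, h2, h.blossom_notMem_triangle ((hG.isBlossom_iff _).2 ⟨h1, h2⟩) h3⟩
    · rintro ⟨h1, h2, h3⟩
      exact ⟨⟨h1, h2⟩, fun e => h3 (Or.inl e)⟩
  · intro y hy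
    exact h.nextDart_close hb htF (hG.nextDart y hy) (by rintro rfl; exact hy hb)
  · intro t h1 h2
    by_cases hα : F.α (F.ξ t) = b
    · obtain ⟨t', ht', hs⟩ := hG.isSucc_of_canClose hF h (t := t) (by
        rw [← hα, ← hG.α_eq, G.α_invol])
      refine ⟨t', ?_, hs⟩
      rw [hα, ht']
      have := NextDart.base (F := F) (s := (G.close b).σ) (y := b)
      rw [h.close_σ_self] at this
      exact this htF
    · rw [h.isBlossom_close] at h2
      obtain ⟨t', h3, h4⟩ := hG.nextDart_blossom t h1 (fun e => h2 ⟨e, hα⟩)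
      exact ⟨t', h.nextDart_close hb htF h3 hα, h4⟩

/-- Induction on the local closures that lead from `F` to `G`. -/
theorem closure_induction (hF : F.IsCyclicForest p) {motive : MarkedMap D → Prop}
    (base : motive ⟨F, F.σ F.root⟩)
    (step : ∀ (G : MarkedMap D) (b : D), IsPartialClosure F G → G.CanClose b → motive G →
      motive (G.close b))
    (h : Relation.ReflTransGen LocalClosure ⟨F, F.σ F.root⟩ G) : IsPartialClosure F G ∧ motive G := by
  induction h with
  | refl => exact ⟨isPartialClosure_self hF, base⟩
  | tail _ h ih =>
    obtain ⟨b, hb, rfl⟩ := h.exists_canClose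
    exact ⟨ih.1.close hF hb, step _ b ih.1 hb ih.2⟩

end

end MarkedMap

/-! ### The complete closure: no stem remains, and proper vertices and the root face are preserved.
-/

namespace PlaneMap

variable {D : Type*} {F : PlaneMap D} {p : ℕ}

theorem NextDart.not_isBlossom {s : Equiv.Perm D} {y z : D} (h : F.NextDart s y z) :
    ¬ F.IsBlossom z := by
  induction h with
  | base h => exact h
  | step _ _ ih => exact ih

theorem NextDart.exists_pow {s : Equiv.Perm D} {y z : D} (h : F.NextDart s y z) :
    ∃ k, 0 < k ∧ z = (s ^ k) y ∧ ∀ j, 0 < j → j < k → F.IsBlossom ((s ^ j) y) := by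
  induction h with
  | base h => exact ⟨1, one_pos, by simp, fun j _ _ => by omega⟩
  | @step y z hy _ ih =>
    obtain ⟨k, hk, rfl, hj⟩ := ih
    refine ⟨k + 1, by omega, by rw [pow_succ, Equiv.Perm.mul_apply], fun j h0 hjk => ?_⟩
    obtain ⟨j, rfl⟩ := Nat.exists_eq_succ_of_ne_zero h0.ne'
    rw [Nat.succ_eq_add_one, pow_succ, Equiv.Perm.mul_apply]
    rcases j.eq_zero_or_pos with rfl | hj0
    · simpa using hy
    · exact hj j hj0 (by omega)

theorem NextDart.vert_eq {G : PlaneMap D} {y z : D} (h : F.NextDart G.σ y z) :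
    G.vert z = G.vert y := by
  induction h with
  | base h => simp
  | step _ _ ih => simpa using ih

theorem lam_add_mul_N (h : F.lam F.N = -3) (i k : ℕ) :
    F.lam (i + k * F.N) = F.lam i - 3 * k := by
  induction k with
  | zero => simp
  | succ k ih =>
    rw [show i + (k + 1) * F.N = i + k * F.N + F.N by ring, lam_add_N, ih, h]
    push_cast
    ring

theorem exists_forall_lam_lt [Finite D] (h : F.lam F.N = -3) (l : ℤ) :
    ∃ n, ∀ t, n ≤ t → F.lam t < l := by
  obtain ⟨B, hB⟩ := ((Set.finite_Iio F.N).image F.lam).bddAbove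
  refine ⟨F.N * (B - l + 1).toNat, fun t ht => ?_⟩
  have h1 := lam_add_mul_N h (t % F.N) (t / F.N)
  rw [Nat.mod_add_div'] at h1
  have h2 := hB ⟨_, Nat.mod_lt t F.N_pos, rfl⟩
  have h3 : (B - l + 1).toNat ≤ t / F.N := (Nat.le_div_iff_mul_le F.N_pos).2 (by rwa [mul_comm])
  omega

end PlaneMap

namespace MarkedMap

open PlaneMap

variable {D : Type*} {F : PlaneMap D} {p : ℕ} {G : MarkedMap D}

namespace IsPartialClosure

/-- If a blossom remains and nothing can be closed, one of the two edges after its stem is again a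
stem. The next blossom has a label at least as large, because the stem raised the label by 1 and at
most one proper edge lowered it. Repeating this contradicts the fact that labels tend to `-∞`. -/
theorem not_isBlossom_of_maximal [Finite D] (hF : F.IsBlossomingForest p)
    (hG : IsPartialClosure F G) (hmax : ∀ b, ¬ G.CanClose b) (x : D) : ¬ G.IsBlossom x := by
  intro hx
  have hc := hF.isCyclicForest
  have key : ∀ t, G.IsBlossom (F.ξ t) → ∃ t', t < t' ∧ G.IsBlossom (F.ξ t') ∧
      F.lam t ≤ F.lam t' := by
    intro t ht
    obtain ⟨hb, hbA⟩ := (hG.isBlossom_iff _).1 ht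
    obtain ⟨t₁, -, e₁, h₁, -, -⟩ := hG.step t hbA
    obtain rfl := h₁ ht
    have l₁ : F.lam (t + 1) = F.lam t + 1 := by rw [lam_succ, incr, if_pos hb]
    have hA₁ : F.ξ (t + 1) ∈ G.markedFace := by rw [← e₁]; simpa using hbA
    have nb₁ : ¬ G.IsBlossom (F.ξ (t + 1)) := by
      rw [← e₁, PlaneMap.isBlossom_φ, hG.isBlossom_iff, hG.α_eq]
      exact fun h => hc.not_isBlossom_α_of_isBlossom hb h.1
    have stem : ∀ s, F.ξ s ∈ G.markedFace → ¬ G.IsBlossom (F.ξ s) → G.IsBlossom (F.α (F.ξ s)) →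
        G.IsBlossom (F.ξ (s + 1)) ∧ F.lam (s + 1) = F.lam s := by
      intro s hs h1 h2
      obtain ⟨s', -, e, -, h, -⟩ := hG.step s hs
      obtain rfl := h h2
      constructor
      · rw [← e, PlaneMap.isBlossom_φ, hG.α_eq]; exact h2
      · rw [lam_succ, incr, if_neg (fun h => h1 ((hG.isBlossom_iff _).2 ⟨h, hs⟩)),
          if_pos ((hG.isBlossom_iff _).1 h2).1, add_zero]
    by_cases hα : G.IsBlossom (F.α (F.ξ (t + 1)))
    · obtain ⟨h1, h2⟩ := stem _ hA₁ nb₁ hα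
      exact ⟨_, by omega, h1, by omega⟩
    · obtain ⟨t₂, ht₂, e₂, -, -, h₂⟩ := hG.step (t + 1) hA₁
      obtain ⟨-, l₂, -⟩ := h₂ nb₁ hα
      have hA₂ : F.ξ t₂ ∈ G.markedFace := by rw [← e₂]; simpa using hA₁
      have nb₂ : ¬ G.IsBlossom (F.ξ t₂) := by
        rw [← e₂, PlaneMap.isBlossom_φ, hG.α_eq]; exact hα
      have hα₂ : G.IsBlossom (F.α (F.ξ t₂)) := by
        by_contra hα₂
        refine hmax _ ⟨ht, ?_, ?_⟩
        · rw [e₁]; exact ⟨nb₁, by rwa [hG.α_eq]⟩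
        · rw [e₁, e₂]; exact ⟨nb₂, by rwa [hG.α_eq]⟩
      obtain ⟨h1, h2⟩ := stem _ hA₂ nb₂ hα₂
      exact ⟨_, by omega, h1, by omega⟩
  obtain ⟨t₀, rfl⟩ := hG.exists_ξ x ((hG.isBlossom_iff _).1 hx).2
  obtain ⟨n, hn⟩ := exists_forall_lam_lt hF.lam_N (F.lam t₀)
  have : ∀ m, ∃ t, m ≤ t ∧ G.IsBlossom (F.ξ t) ∧ F.lam t₀ ≤ F.lam t := by
    intro m
    induction m with
    | zero => exact ⟨t₀, by omega, hx, le_rfl⟩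
    | succ m ih =>
      obtain ⟨t, h1, h2, h3⟩ := ih
      obtain ⟨t', h4, h5, h6⟩ := key t h2
      exact ⟨t', by omega, h5, h3.trans h6⟩
  obtain ⟨t, h1, -, h3⟩ := this n
  exact absurd (hn t h1) (not_lt.2 h3)

theorem vert_eq_of_vert_eq [Finite D] (hG : IsPartialClosure F G) {x y : D} (hx : ¬ F.IsBlossom x)
    (h : F.vert x = F.vert y) : G.vert x = G.vert y := by
  have := (F.vert_eq_iff.1 h).mem_of_mapsTo
    (S := {z | ¬ F.IsBlossom z ∧ G.vert x = G.vert z}) ?_ ⟨hx, rfl⟩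
  · exact this.2
  · rintro z ⟨h1, h2⟩
    exact ⟨F.isBlossom_σ.not.2 h1, h2.trans (hG.nextDart z h1).vert_eq.symm⟩

theorem vert_eq_iff [Finite D] (hG : IsPartialClosure F G) {x y : D} (hx : ¬ F.IsBlossom x)
    (hy : ¬ F.IsBlossom y) : G.vert x = G.vert y ↔ F.vert x = F.vert y := by
  refine ⟨fun h => ?_, hG.vert_eq_of_vert_eq hx⟩
  obtain ⟨k, rfl⟩ := (G.vert_eq_iff.1 h).exists_nat_pow_eq
  clear h
  induction k using Nat.strong_induction_on generalizing x with
  | _ k ih =>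
    rcases k.eq_zero_or_pos with rfl | hk
    · simp
    -- A rotation in `G` is cut into jumps over attached darts; each jump is a single rotation in
    -- `F`.
    obtain ⟨m, hm, e, hj⟩ := (hG.nextDart x hx).exists_pow
    have hmk : m ≤ k := by
      by_contra! hlt
      exact hy (hj k hk hlt)
    have h1 : (G.σ ^ k) x = (G.σ ^ (k - m)) (F.σ x) := by
      rw [e, ← Equiv.Perm.mul_apply, ← pow_add, Nat.sub_add_cancel hmk]
    rw [h1] at hy ⊢
    rw [← ih (k - m) (by omega) (F.isBlossom_σ.not.2 hx) hy, F.vert_σ]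

theorem face_eq_root_iff [Finite D] (hG : IsPartialClosure F G) {x : D} :
    G.face x = G.face G.root ↔ x ∈ F.rootFace := by
  constructor
  · intro h
    refine (G.face_eq_iff.1 h.symm).mem_of_mapsTo (fun z hz => ?_) (hG.root_eq ▸ F.root_mem)
    rw [hG.φ_root z hz]; simpa using hz
  · intro h
    refine ((F.face_eq_iff.1 (Eq.symm h)).mem_of_mapsTo
      (S := {z | z ∈ F.rootFace ∧ G.face z = G.face G.root}) ?_ ⟨F.root_mem, ?_⟩).2
    · rintro z ⟨h1, h2⟩
      exact ⟨by simpa using h1, by rw [← hG.φ_root z h1]; simpa using h2⟩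
    · rw [hG.root_eq]

theorem onRootFace_iff [Finite D] (hF : F.IsCyclicForest p) (hG : IsPartialClosure F G) {x : D}
    (hx : ¬ F.IsBlossom x) : G.OnRootFace x ↔ F.OnRootFace x := by
  simp only [OnRootFace, hG.face_eq_root_iff]
  refine exists_congr fun y => and_congr_right fun hy => ?_
  exact hG.vert_eq_iff (hF.not_isBlossom hy) hx

/-- Each dart of the closure starts at a vertex that is not a blossom. -/
theorem exists_vert_eq [Finite D] (hF : F.IsCyclicForest p) (hG : IsPartialClosure F G)
    (hmax : ∀ b, ¬ G.IsBlossom b) (x : D) : ∃ y, ¬ F.IsBlossom y ∧ G.vert y = G.vert x := by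
  by_cases hx : F.IsBlossom x
  · have : F.α x ∉ F.rootFace := by
      intro h
      have := hF.not_isBlossom_α h
      rw [F.α_invol] at this
      exact this hx
    obtain ⟨t, -, ht⟩ := hF.exists_ξ this
    have hα : F.α (F.ξ t) = x := by rw [ht, F.α_invol]
    obtain ⟨t', h, -⟩ := hG.nextDart_blossom t (hα ▸ hx) (hmax _)
    exact ⟨F.ξ t', h.not_isBlossom, by rw [h.vert_eq, hα]⟩
  · exact ⟨x, hx, rfl⟩

end IsPartialClosure

/-! ### Cuts and potentials, by induction on the local closures. -/

/-- No set of faces that avoids the marked face is bounded by darts that neither start at a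
blossom nor lie on the root face. -/
def NoDirectedCut (F : PlaneMap D) (G : MarkedMap D) : Prop :=
  ∀ S : Set D, (∀ x ∈ S, G.φ x ∈ S) → G.mark ∉ S →
    (∀ d ∈ S, F.α d ∉ S → ¬ F.IsBlossom d ∧ d ∉ F.rootFace) → S = ∅

theorem noDirectedCut_self [Finite D] (hF : F.IsCyclicForest p) :
    NoDirectedCut F ⟨F, F.σ F.root⟩ := by
  intro S hφ hm hS
  have hsub : ∀ x ∈ S, x ∈ F.rootFace := by
    intro x hx
    by_contra hxR
    exact hm ((F.face_eq_iff.1 (hF.face_eq hxR (hF.σ_notMem F.root_mem))).mem_of_mapsTo hφ hx)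
  by_contra hne
  obtain ⟨x, hx⟩ := Set.nonempty_iff_ne_empty.2 hne
  have hr : F.root ∈ S := (F.face_eq_iff.1 (hsub x hx)).mem_of_mapsTo hφ hx
  exact (hS _ hr (fun h => hF.α_notMem F.root_mem (hsub _ h))).2 F.root_mem

/-- The new marked dart `α b` is outside `S`, so `b` is too, since otherwise it would be a boundary
dart starting at a blossom. Thus `S` avoids the new triangle and is already a union of faces of `G`.
-/
theorem NoDirectedCut.close [Finite D] [DecidableEq D] {b : D} (hG : IsPartialClosure F G)
    (h : G.CanClose b) (hN : NoDirectedCut F G) : NoDirectedCut F (G.close b) := by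
  intro S hφ hm hS
  obtain ⟨hb, hbA⟩ := (hG.isBlossom_iff b).1 h.blossom
  have hm : G.α b ∉ S := hm
  have hbS : b ∉ S := fun hbS => (hS b hbS (hG.α_eq ▸ hm)).1 hb
  have h₂ : G.φ (G.φ b) ∉ S := fun h' => hbS (by
    have := hφ _ h'
    rwa [CanClose.close_φ_last] at this)
  have hφ' : ∀ x ∈ S, G.φ x ∈ S := by
    intro x hx
    have := hφ x hx
    rwa [h.close_φ_of_ne (by rintro rfl; exact hm hx) (by rintro rfl; exact h₂ hx)] at this
  refine hN S hφ' (fun h' => hm ?_) hS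
  exact markedFace_subset (mark_mem G) hφ' h' (h.α_mem_markedFace hbA)

variable [Fintype D]

/-- A flow that is conserved at all vertices not on the root face derives from a potential on
the faces. -/
def HasPotentials (F : PlaneMap D) (G : MarkedMap D) : Prop :=
  ∀ δ : D → ℤ, (∀ d, δ (F.α d) = -δ d) →
    (∀ f : D → ℤ, (∀ d, f (G.σ d) = f d) → (∀ d ∈ F.rootFace, f d = 0) → ∑ d, f d * δ d = 0) →
    ∃ h : D → ℤ, (∀ d, h (G.φ d) = h d) ∧
      ∀ d, d ∉ F.rootFace → F.α d ∉ F.rootFace → h d - h (F.α d) = δ d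

/-- A forest carries no nonzero conserved flow off the root cycle. Going down from the largest rank,
the flow on a parent dart vanishes because conservation at its origin involves only children already
treated. The zero potential then works. -/
theorem hasPotentials_self (hF : F.IsCyclicForest p) : HasPotentials F ⟨F, F.σ F.root⟩ := by
  classical
  intro δ hδ hf
  obtain ⟨P, r, hP⟩ := hF.exists_isParentSet
  obtain ⟨K, hK⟩ := (Set.finite_range r).bddAbove
  have key : ∀ n, ∀ d ∈ P, K + 1 ≤ r d + n → δ d = 0 := by
    intro n
    induction n with
    | zero =>
      intro d _ hd
      have := hK ⟨d, rfl⟩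
      omega
    | succ n ih =>
      intro d hd hn
      have := hf (fun x => if F.vert x = F.vert d then 1 else 0) (fun x => by simp)
        (fun x hx => if_neg fun e =>
          hP.not_onRootFace d hd ((onRootFace_congr F e).1 (F.onRootFace_of_mem hx)))
      rw [Finset.sum_eq_single d] at this
      · simpa using this
      · intro x _ hxd
        by_cases hv : F.vert x = F.vert d
        · have hxO : ¬ F.OnRootFace x := fun h =>
            hP.not_onRootFace d hd ((onRootFace_congr F hv).1 h)
          have h1 : x ∉ F.rootFace := fun h => hxO (F.onRootFace_of_mem h)
          have h2 : F.α x ∉ F.rootFace := fun h => hxO (by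
            have := F.onRootFace_α h
            rwa [F.α_invol] at this)
          have h3 : F.α x ∈ P := by
            by_contra h3
            exact hxd (hP.eq_of_vert_eq x ((hP.mem_iff x h1 h2).2 h3) d hd hv)
          have h4 := hP.lt _ h3
          rw [F.α_invol, (F.vert_eq_iff.1 hv).eq_of_forall hP.rank_σ] at h4
          have h5 := ih _ h3 (by omega)
          rw [hδ] at h5
          rw [neg_eq_zero.1 h5, mul_zero]
        · simp [hv]
      · simp
  refine ⟨fun _ => 0, fun _ => rfl, fun d h1 h2 => ?_⟩
  by_cases hd : d ∈ P
  · rw [key (K + 1) d hd (by omega), sub_zero]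
  · have hd' : F.α d ∈ P := by
      by_contra h
      exact hd ((hP.mem_iff d h1 h2).2 h)
    have := key (K + 1) _ hd' (by omega)
    rw [hδ, neg_eq_zero] at this
    rw [this, sub_zero]

/-- Adding a multiple of the indicator of the new triangle to a potential corrects the flow on `b`.
Subtracting that contribution leaves a flow that vanishes on `b`, hence is conserved in `G` as well.
-/
theorem HasPotentials.close [DecidableEq D] {b : D} (hF : F.IsCyclicForest p)
    (hG : IsPartialClosure F G) (hc : G.CanClose b) (hH : HasPotentials F G) :
    HasPotentials F (G.close b) := by
  classical
  intro δ hδ hf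
  obtain ⟨hb, hbA⟩ := (hG.isBlossom_iff b).1 hc.blossom
  have hbR : b ∉ F.rootFace := fun h => hF.not_isBlossom h hb
  let g : D → ℤ := fun d => if d ∈ G.triangle b then 1 else 0
  have hg : ∀ d, g ((G.close b).φ d) = g d := by
    intro d
    by_cases h1 : d = G.α b
    · rw [h1, hc.close_φ_α]
      simp [g, hc.target_notMem, hc.α_notMem]
    by_cases h2 : d = G.φ (G.φ b)
    · rw [h2, CanClose.close_φ_last]
      simp [g, triangle]
    · rw [hc.close_φ_of_ne h1 h2]
      have h3 : G.φ d = b ↔ False := iff_of_false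
        (fun e => h1 (G.φ.injective (e.trans hc.φ_α.symm))) id
      simp [g, triangle, h3, h2]
  have hgb : g b = 1 := by simp [g, triangle]
  have hgα : g (G.α b) = 0 := by simp [g, hc.α_notMem]
  have hσ : ∀ d, g (F.α d) = g ((G.close b).σ d) := by
    intro d
    rw [← hg (F.α d), φ_apply, close_α, hG.α_eq, F.α_invol]
  let δ' : D → ℤ := fun d => δ d - δ b * (g d - g (F.α d))
  have hδb : δ' b = 0 := by
    simp only [δ', hgb, ← hG.α_eq, hgα]; ring
  obtain ⟨h, h1, h2⟩ := hH δ' (by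
      intro d
      simp only [δ', hδ, F.α_invol]; ring) (by
      intro f hfσ hf0
      -- In `G` the value of a test function at the blossom `b` is free; in the closed map it must
      -- agree with the value at the target. The change is harmless since `δ' b = 0`.
      let f' : D → ℤ := fun d => if d = b then f (G.target b) else f d
      have hf'σ : ∀ d, f' ((G.close b).σ d) = f' d := by
        intro d
        by_cases hd : d = b
        · subst hd
          rw [hc.close_σ_self]
          simp [f']
        by_cases hd' : G.σ d = G.target b
        · rw [CanClose.close_σ_of_eq hd']
          simp [f', ← hd', hfσ]
        · have : G.σ d ≠ b := by
            intro e
            rw [← show G.σ b = b from hc.blossom] at e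
            exact hd (G.σ.injective e)
          rw [hc.close_σ_of_ne hd hd']
          simp [f', hd, this, hfσ]
      have hf'0 : ∀ d ∈ F.rootFace, f' d = 0 := by
        intro d hd
        simp only [f']
        rw [if_neg (by rintro rfl; exact hbR hd), hf0 d hd]
      have e1 : ∑ d, f d * δ' d = ∑ d, f' d * δ' d := by
        refine Finset.sum_congr rfl fun d _ => ?_
        by_cases hd : d = b
        · rw [hd, hδb, mul_zero, mul_zero]
        · simp [f', hd]
      have e2 : ∑ d, f' d * g (F.α d) = ∑ d, f' d * g d := by
        rw [← Equiv.sum_comp (G.close b).σ (fun d => f' d * g d)]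
        exact Finset.sum_congr rfl fun d _ => by rw [hf'σ, hσ]
      have e3 : ∀ d, f' d * δ' d = f' d * δ d - δ b * (f' d * g d - f' d * g (F.α d)) :=
        fun d => by simp only [δ']; ring
      rw [e1]
      simp_rw [e3]
      rw [Finset.sum_sub_distrib, ← Finset.mul_sum, Finset.sum_sub_distrib, e2, hf f' hf'σ hf'0]
      ring)
  have h3 : h (G.target b) = h b := by simp only [target, h1]
  refine ⟨fun d => h d + δ b * g d, fun d => ?_, fun d hd hd' => ?_⟩
  · beta_reduce
    rw [hg]
    congr 1
    rw [close_φ]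
    by_cases e1 : G.φ d = b
    · rw [e1, Equiv.swap_apply_left, h3, ← h1 d, e1]
    by_cases e2 : G.φ d = G.target b
    · rw [e2, Equiv.swap_apply_right, ← h3, ← e2, h1]
    · rw [Equiv.swap_apply_of_ne_of_ne e1 e2, h1]
  · have := h2 d hd hd'
    simp only [δ'] at this
    linear_combination this

/-- Properties of the closure `M` of a blossoming forest `F`. -/
theorem IsClosure.properties [DecidableEq D] {M : MarkedMap D} (hF : F.IsBlossomingForest p)
    (hM : M.IsClosure F) : IsPartialClosure F M ∧ (∀ x, ¬ M.IsBlossom x) ∧ NoDirectedCut F M ∧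
      HasPotentials F M := by
  have hc := hF.isCyclicForest
  obtain ⟨h1, h2, h3⟩ := closure_induction hc
    (motive := fun G => NoDirectedCut F G ∧ HasPotentials F G)
    ⟨noDirectedCut_self hc, hasPotentials_self hc⟩
    (fun G b hG hb h => ⟨h.1.close hG hb, h.2.close hc hG hb⟩) hM.1
  refine ⟨h1, h1.not_isBlossom_of_maximal hF fun b hb => ?_, h2, h3⟩
  exact hM.2 _ ⟨b, hb.blossom, hb.proper₁, hb.proper₂, rfl⟩

end MarkedMap

/-! ### In a minimal orientation, stems point to their blossoms. -/

namespace MarkedMap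

open PlaneMap

variable {D : Type*} {F : PlaneMap D} {p : ℕ} {M : MarkedMap D}

theorem reflTransGen_step_symm [Finite D] {n : ℕ} {c : ZMod n → D} {x y : D}
    (h : Relation.ReflTransGen (M.Step c) x y) : Relation.ReflTransGen (M.Step c) y x := by
  induction h with
  | refl => exact .refl
  | @tail y z _ h ih =>
    refine Relation.ReflTransGen.trans ?_ ih
    obtain rfl | ⟨rfl, h⟩ := h
    · exact (Equiv.Perm.sameCycle_apply_left.2 (Equiv.Perm.SameCycle.refl M.φ y)).mem_of_mapsTo
        (S := {w | Relation.ReflTransGen (M.Step c) (M.φ y) w})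
        (fun w hw => hw.tail (Or.inl rfl)) .refl
    · refine .single (Or.inr ⟨(M.α_invol y).symm, fun i => ?_⟩)
      rw [M.α_invol]
      exact (h i).symm

theorem exists_isDirectedCycle [Finite D] {C O : Set D} (hne : C.Nonempty) (hCO : C ⊆ O)
    (hC : ∀ d ∈ C, ∃ d' ∈ C, M.vert d' = M.vert (M.α d)) :
    ∃ (n : ℕ) (c : ZMod n → D), 0 < n ∧ (∀ i, c i ∈ C) ∧ M.IsDirectedCycle O c := by
  classical
  choose! nxt hnxt hvert using hC
  obtain ⟨d₀, hd₀⟩ := hne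
  let s : ℕ → D := fun k => nxt^[k] d₀
  have hs : ∀ k, s k ∈ C := by
    intro k
    induction k with
    | zero => exact hd₀
    | succ k ih => simp only [s, Function.iterate_succ_apply']; exact hnxt _ ih
  have hv : ∀ k, M.vert (s (k + 1)) = M.vert (M.α (s k)) := by
    intro k
    simp only [s, Function.iterate_succ_apply']
    exact hvert _ (hs k)
  -- Taking the shortest gap between two visits to a vertex, over all starting times, makes the
  -- cycle simple.
  have hex : ∃ n, 0 < n ∧ ∃ i, M.vert (s i) = M.vert (s (i + n)) := by
    obtain ⟨i, j, hij, h⟩ := Finite.exists_ne_map_eq_of_infinite s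
    rcases lt_or_gt_of_ne hij with hlt | hlt
    · exact ⟨j - i, by omega, i, by rw [Nat.add_sub_cancel' hlt.le, h]⟩
    · exact ⟨i - j, by omega, j, by rw [Nat.add_sub_cancel' hlt.le, h]⟩
  obtain ⟨hn, i, hi⟩ := Nat.find_spec hex
  have hmin := fun m => Nat.find_min hex (m := m)
  generalize Nat.find hex = n at hn hi hmin
  have : NeZero n := ⟨hn.ne'⟩
  refine ⟨n, fun k => s (i + k.val), hn, fun k => hs _, fun k => hCO (hs _), fun k => ?_, ?_⟩
  · have hlt := ZMod.val_lt k
    have h1 : (k + 1).val = (k.val + 1) % n := by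
      rw [ZMod.val_add, ZMod.val_one_eq_one_mod, Nat.add_mod_mod]
    beta_reduce
    rw [← hv, h1]
    rcases (show k.val + 1 ≤ n from hlt).lt_or_eq with h2 | h2
    · rw [Nat.mod_eq_of_lt h2]; rfl
    · rw [h2, Nat.mod_self, add_zero, hi, add_assoc, h2]
  · have aux : ∀ k l : ZMod n, k.val < l.val → M.vert (s (i + k.val)) ≠ M.vert (s (i + l.val)) := by
      intro k l hkl e
      have hlt := ZMod.val_lt l
      refine hmin (l.val - k.val) (by omega) ⟨by omega, i + k.val, ?_⟩
      rw [e]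
      congr 2
      omega
    intro k l e
    rcases lt_trichotomy k.val l.val with h | h | h
    · exact absurd e (aux k l h)
    · exact ZMod.val_injective n h
    · exact absurd e.symm (aux l k h)

/-- A set of faces that avoids the marked face is not bounded by darts of an
orientation without counterclockwise cycles. -/
theorem eq_empty_of_boundary_subset [Finite D] {O S : Set D}
    (hconn : ∀ T : Set D, T.Nonempty → (∀ x ∈ T, M.σ x ∈ T) → (∀ x ∈ T, M.α x ∈ T) → ∀ y, y ∈ T)
    (hO : ∀ (n : ℕ) (c : ZMod n → D), 0 < n → M.IsDirectedCycle O c → ¬ M.MarkedOnRight c)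
    (hφ : ∀ x ∈ S, M.φ x ∈ S) (hm : M.mark ∉ S) (hS : ∀ d ∈ S, M.α d ∉ S → d ∈ O) : S = ∅ := by
  by_contra hne
  obtain ⟨x₀, hx₀⟩ := Set.nonempty_iff_ne_empty.2 hne
  -- `T` is the region reached from the marked face without crossing the boundary of `S`. The darts
  -- of `C` have `T` on their right, and they lie on the boundary of `S`, hence in `O`.
  let R : D → D → Prop := fun x y => y = M.φ x ∨ (y = M.α x ∧ (x ∈ S ↔ M.α x ∈ S))
  let T : Set D := {x | Relation.ReflTransGen R M.mark x}
  have hback : ∀ {U : Set D}, (∀ x ∈ U, M.φ x ∈ U) → ∀ x, M.φ x ∈ U → x ∈ U := fun hU x hx =>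
    (Equiv.Perm.sameCycle_apply_left.2 (Equiv.Perm.SameCycle.refl M.φ x)).mem_of_mapsTo hU hx
  have hTφ : ∀ x ∈ T, M.φ x ∈ T := fun x hx => hx.tail (Or.inl rfl)
  have hTS : ∀ x ∈ T, x ∉ S := by
    intro x hx
    induction hx with
    | refl => exact hm
    | tail _ h ih =>
      obtain rfl | ⟨rfl, h⟩ := h
      · exact fun h => ih (hback hφ _ h)
      · exact fun h' => ih (h.2 h')
  let C : Set D := {d | M.α d ∈ T ∧ d ∉ T}
  have hCS : ∀ d ∈ C, d ∈ S := by
    rintro d ⟨h1, h2⟩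
    by_contra hd
    refine h2 (h1.tail (Or.inr ⟨(M.α_invol d).symm, ?_⟩))
    rw [M.α_invol]
    exact iff_of_false (hTS _ h1) hd
  have hCO : C ⊆ O := fun d hd => hS d (hCS d hd) (hTS _ hd.1)
  have hCne : C.Nonempty := by
    by_contra hC
    have hTα : ∀ x ∈ T, M.α x ∈ T := by
      intro x hx
      by_contra h
      exact hC ⟨M.α x, by rwa [Set.mem_ofPred_eq, M.α_invol], h⟩
    refine hTS x₀ (hconn T ⟨M.mark, .refl⟩ (fun x hx => ?_) hTα x₀) hx₀
    rw [← M.φ_α]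
    exact hTφ _ (hTα _ hx)
  -- If no dart of `C` left the end of `d`, turning around this vertex from `α d` would never leave
  -- `T`, and would finally put `d` in `T`.
  have hCnext : ∀ d ∈ C, ∃ d' ∈ C, M.vert d' = M.vert (M.α d) := by
    rintro d ⟨hd, hdT⟩
    by_contra! hno
    have hpred : ∀ z, M.σ z ∈ T → M.vert z = M.vert (M.α d) → M.α z ∈ T ∧ z ∈ T := by
      intro z hz hv
      have h1 : M.α z ∈ T := hback hTφ _ (by rwa [M.φ_α])
      refine ⟨h1, ?_⟩
      by_contra h2
      exact hno z ⟨h1, h2⟩ hv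
    have hall : ∀ z, M.vert z = M.vert (M.α d) → z ∈ T := by
      intro z hz
      have := (Equiv.Perm.sameCycle_inv.2 (M.vert_eq_iff.1 hz.symm)).mem_of_mapsTo
        (S := {w | M.vert w = M.vert (M.α d) ∧ w ∈ T}) ?_ ⟨rfl, hd⟩
      · exact this.2
      · rintro w ⟨hw, hwT⟩
        have hσw : M.σ (M.σ⁻¹ w) = w := M.σ.apply_symm_apply w
        have hv : M.vert (M.σ⁻¹ w) = M.vert (M.α d) := by
          rw [← M.vert_σ, hσw, hw]
        exact ⟨hv, (hpred _ (by rwa [hσw]) hv).2⟩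
    have := (hpred (M.α d) (hall _ (M.vert_σ _)) rfl).1
    rw [M.α_invol] at this
    exact hdT this
  obtain ⟨n, c, hn, hcC, hc⟩ := exists_isDirectedCycle hCne hCO hCnext
  refine hO n c hn hc ⟨0, reflTransGen_step_symm ?_⟩
  refine Relation.ReflTransGen.mono (r := R) ?_ _ _ (hcC 0).1
  rintro x y (rfl | ⟨rfl, h⟩)
  · exact Or.inl rfl
  · refine Or.inr ⟨rfl, fun i => ⟨?_, ?_⟩⟩
    · rintro rfl
      exact hTS _ (hcC i).1 (h.1 (hCS _ (hcC i)))
    · intro e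
      have h1 := hCS _ (hcC i)
      have h2 := hTS _ (hcC i).1
      rw [e] at h1 h2
      rw [M.α_invol] at h2
      exact h2 (h.2 h1)

theorem IsPartialClosure.connected [Finite D] (hF : F.IsCyclicForest p) (hG : IsPartialClosure F M)
    (T : Set D) (hT : T.Nonempty) (hσ : ∀ x ∈ T, M.σ x ∈ T) (hα : ∀ x ∈ T, M.α x ∈ T) (y : D) :
    y ∈ T := by
  refine F.connected_induction hF.connected hT (fun x hx => ?_) (fun x hx => hG.α_eq ▸ hα x hx) y
  by_cases hb : F.IsBlossom x
  · rwa [show F.σ x = x from hb]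
  · exact (M.vert_eq_iff.1 (hG.nextDart x hb).vert_eq.symm).mem_of_mapsTo hσ hx

/-- The orientation whose darts are the stems and the given parent darts, with a clockwise root
face. -/
def parentOrientation (F : PlaneMap D) (P : Set D) : Set D :=
  {d | d ∉ F.rootFace ∧ (F.α d ∈ F.rootFace ∨ F.IsBlossom (F.α d) ∨ (¬ F.IsBlossom d ∧ d ∈ P))}

section

variable [Finite D] {P : Set D} {r : D → ℕ}

theorem mem_parentOrientation_iff (hF : F.IsCyclicForest p) (hP : F.IsParentSet P r) (d : D) :
    d ∈ parentOrientation F P ↔ F.α d ∉ parentOrientation F P := by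
  by_cases hR : d ∈ F.rootFace
  · exact iff_of_false (fun h => h.1 hR) (not_not.2 ⟨hF.α_notMem hR, Or.inl (by rwa [F.α_invol])⟩)
  by_cases hR' : F.α d ∈ F.rootFace
  · exact iff_of_true ⟨hR, Or.inl hR'⟩ (fun h => h.1 hR')
  have h1 := hF.not_isBlossom_α_of_isBlossom (b := d)
  have h2 := hP.mem_of_isBlossom hF (b := d)
  have h3 := hP.mem_of_isBlossom hF (b := F.α d)
  have h4 := hP.mem_iff d hR hR'
  simp only [parentOrientation, Set.mem_ofPred_eq, F.α_invol, hR, hR', not_false_eq_true, true_and,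
    false_or]
  by_cases hb : F.IsBlossom d
  · simp [hb, h1 hb]
  by_cases hb' : F.IsBlossom (F.α d)
  · simp [hb, hb']
  · simp [hb, hb', h4]

theorem not_isBlossom_of_mem (hF : F.IsCyclicForest p) {d : D} (hd : d ∈ parentOrientation F P) :
    ¬ F.IsBlossom d := by
  intro hb
  obtain ⟨-, h | h | h⟩ := hd
  · have := hF.not_isBlossom_α h
    rw [F.α_invol] at this
    exact this hb
  · exact hF.not_isBlossom_α_of_isBlossom hb h
  · exact h.1 hb

/-- The three outgoing darts are the two stems and the parent dart. The latter is not a stem,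
because the blossom's own parent dart already uses that edge. -/
theorem ncard_parentOrientation (hF : F.IsBlossomingForest p) (hP : F.IsParentSet P r)
    (hG : IsPartialClosure F M) {x : D} (hx : ¬ F.IsBlossom x) (hx' : ¬ F.OnRootFace x) :
    {d | M.vert d = M.vert x ∧ d ∈ parentOrientation F P}.ncard = 3 := by
  have hc := hF.isCyclicForest
  obtain ⟨d₀, hd₀, hv₀⟩ := hP.exists_vert_eq x hx'
  have hb₀ : ¬ F.IsBlossom d₀ := fun h => hx (by
    rw [← F.eq_of_vert_eq_of_isBlossom h hv₀] at h; exact h)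
  have hR : ∀ d, F.vert d = F.vert x → d ∉ F.rootFace ∧ F.α d ∉ F.rootFace := by
    intro d hd
    constructor
    · exact fun h => hx' ((onRootFace_congr F hd).1 (F.onRootFace_of_mem h))
    · intro h
      have := F.onRootFace_α h
      rw [F.α_invol] at this
      exact hx' ((onRootFace_congr F hd).1 this)
  have hset : {d | M.vert d = M.vert x ∧ d ∈ parentOrientation F P} =
      insert d₀ {d | F.vert d = F.vert x ∧ F.IsBlossom (F.α d)} := by
    ext d
    constructor
    · rintro ⟨hd, hdO⟩
      have hv := (hG.vert_eq_iff (not_isBlossom_of_mem hc hdO) hx).1 hd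
      obtain ⟨-, h | h | h⟩ := hdO
      · exact absurd h (hR d hv).2
      · exact Or.inr ⟨hv, h⟩
      · exact Or.inl (hP.eq_of_vert_eq d h.2 d₀ hd₀ (hv.trans hv₀.symm))
    · rintro (rfl | ⟨hv, h⟩)
      · exact ⟨hG.vert_eq_of_vert_eq hb₀ hv₀, (hR _ hv₀).1, Or.inr (Or.inr ⟨hb₀, hd₀⟩)⟩
      · have hb : ¬ F.IsBlossom d := fun hb => hc.not_isBlossom_α_of_isBlossom hb h
        exact ⟨hG.vert_eq_of_vert_eq hb hv, (hR d hv).1, Or.inr (Or.inl h)⟩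
  rw [hset, Set.ncard_insert_of_notMem, hF.2.2.1 x hx' hx]
  rintro ⟨-, h⟩
  have h1 := hP.mem_of_isBlossom hc h
  exact (hP.mem_iff d₀ (hR _ hv₀).1 (hR _ hv₀).2).1 hd₀ h1

end

theorem sum_boole_vert_eq [Fintype D] (O : Set D) (v : M.Vertex) [DecidablePred (· ∈ O)]
    [DecidablePred fun d => M.vert d = v] :
    ∑ d with M.vert d = v, (if d ∈ O then (1 : ℤ) else 0) = {d | M.vert d = v ∧ d ∈ O}.ncard := by
  rw [Finset.sum_boole, Finset.filter_filter, ← Set.ncard_coe_finset]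
  simp

/-- In a minimal `3`-orientation of the closure, each stem is oriented towards its blossom. -/
theorem IsMinimalOrientation.notMem_of_isBlossom [Fintype D] [DecidableEq D]
    (hF : F.IsBlossomingForest p) (hM : M.IsClosure F) {O : Set D} (hO : M.IsMinimalOrientation O)
    {b : D} (hb : F.IsBlossom b) : b ∉ O := by
  classical
  have hc := hF.isCyclicForest
  obtain ⟨hG, hnb, hcut, hpot⟩ := hM.properties hF
  obtain ⟨hO₁, hO₂, hO₃, hO₄⟩ := hO
  obtain ⟨P, r, hP⟩ := hc.exists_isParentSet
  have hO₀ := mem_parentOrientation_iff hc hP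
  set O₀ := parentOrientation F P with hO₀def
  let o : D → ℤ := fun d => if d ∈ O then 1 else 0
  let o₀ : D → ℤ := fun d => if d ∈ O₀ then 1 else 0
  rw [hG.α_eq] at hO₁
  -- Conservation: the test function vanishes at vertices of the root face, and elsewhere both
  -- orientations have outdegree 3.
  obtain ⟨h, hφ, hh⟩ := hpot (fun d => o d - o₀ d) (by
      intro d
      have h1 : o (F.α d) = 1 - o d := by
        by_cases hd : d ∈ O
        · simp [o, hd, (hO₁ d).1 hd]
        · simp [o, hd, not_not.1 (mt (hO₁ d).2 hd)]
      have h2 : o₀ (F.α d) = 1 - o₀ d := by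
        by_cases hd : d ∈ O₀
        · simp [o₀, hd, (hO₀ d).1 hd]
        · simp [o₀, hd, not_not.1 (mt (hO₀ d).2 hd)]
      rw [h1, h2]; ring) (by
    intro f hfσ hf0
    have : Finite M.Vertex := Quotient.finite _
    have : Fintype M.Vertex := Fintype.ofFinite _
    rw [← Finset.sum_fiberwise Finset.univ M.vert]
    refine Finset.sum_eq_zero fun v _ => ?_
    obtain ⟨x, rfl⟩ := M.vert_surj v
    obtain ⟨y, hy, hyx⟩ := hG.exists_vert_eq hc hnb x
    rw [← hyx]
    have hfv : ∀ d, M.vert d = M.vert y → f d = f y := fun d hd =>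
      (M.vert_eq_iff.1 hd).eq_of_forall hfσ
    have e1 : ∑ d with M.vert d = M.vert y, f d * (o d - o₀ d) =
        f y * (∑ d with M.vert d = M.vert y, o d - ∑ d with M.vert d = M.vert y, o₀ d) := by
      rw [← Finset.sum_sub_distrib, Finset.mul_sum]
      exact Finset.sum_congr rfl fun d hd => by rw [hfv d (by simpa using hd)]
    rw [e1]
    by_cases hyR : F.OnRootFace y
    · obtain ⟨z, hz, hzv⟩ := hyR
      rw [← hfv z (hG.vert_eq_of_vert_eq (hc.not_isBlossom hz) hzv), hf0 z hz, zero_mul]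
    · rw [sum_boole_vert_eq, sum_boole_vert_eq, ncard_parentOrientation hF hP hG hy hyR,
        hO₂ y ((hG.onRootFace_iff hc hy).not.2 hyR), sub_self, mul_zero])
  have hφ' : ∀ x, M.φ x ∈ F.rootFace ↔ x ∈ F.rootFace := fun x => by
    rw [← hG.face_eq_root_iff, ← hG.face_eq_root_iff, M.face_φ]
  have hlevel : ∀ m, ∀ x ∈ {d | d ∉ F.rootFace ∧ h d = m}, M.φ x ∈ {d | d ∉ F.rootFace ∧ h d = m} :=
    fun m x hx => ⟨(hφ' x).not.2 hx.1, (hφ x).trans hx.2⟩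
  have hbR : b ∉ F.rootFace := fun h => hc.not_isBlossom h hb
  have hαbR : F.α b ∉ F.rootFace := fun h => by
    have := hc.not_isBlossom_α h
    rw [F.α_invol] at this
    exact this hb
  obtain ⟨u, huR, hu⟩ := Set.exists_max_image F.rootFaceᶜ h (Set.toFinite _) ⟨b, hbR⟩
  obtain ⟨l, hlR, hl⟩ := Set.exists_min_image F.rootFaceᶜ h (Set.toFinite _) ⟨b, hbR⟩
  -- Across the boundary of the maximal level `h` drops, so `o d - o₀ d > 0` and `d ∈ O`. Next to
  -- the root face, `d ∈ O` because its boundary is clockwise.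
  have hum : h M.mark = h u := by
    by_contra hne
    have := eq_empty_of_boundary_subset (S := {d | d ∉ F.rootFace ∧ h d = h u})
      (hG.connected hc) hO₄ (hlevel _) (fun hm => hne hm.2) (fun d hd hd' => ?_)
    · exact (Set.eq_empty_iff_forall_notMem.1 this u) ⟨huR, rfl⟩
    rw [hG.α_eq] at hd'
    by_cases hR : F.α d ∈ F.rootFace
    · have := hO₃ _ (hG.face_eq_root_iff.2 hR)
      rwa [hG.α_eq, F.α_invol] at this
    · have h1 := hh d hd.1 hR
      have h2 := hu _ hR
      have h3 : h (F.α d) ≠ h u := fun e => hd' ⟨hR, e⟩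
      rw [hd.2] at h1
      by_contra hdO
      have h4 : o d = 0 := if_neg hdO
      have h5 : 0 ≤ o₀ d := by simp only [o₀]; split_ifs <;> norm_num
      omega
  -- Across the boundary of the minimal level `h` increases, which is impossible at a dart starting
  -- at a blossom, where `o₀` is 0.
  have hlm : h M.mark = h l := by
    by_contra hne
    have := hcut {d | d ∉ F.rootFace ∧ h d = h l} (hlevel _) (fun hm => hne hm.2)
      (fun d hd hd' => ⟨fun hdb => ?_, hd.1⟩)
    · exact (Set.eq_empty_iff_forall_notMem.1 this l) ⟨hlR, rfl⟩
    have hR : F.α d ∉ F.rootFace := fun h => by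
      have := hc.not_isBlossom_α h
      rw [F.α_invol] at this
      exact this hdb
    have h1 := hh d hd.1 hR
    have h2 := hl _ hR
    have h3 : h (F.α d) ≠ h l := fun e => hd' ⟨hR, e⟩
    rw [hd.2] at h1
    have h4 : o₀ d = 0 := if_neg fun h => not_isBlossom_of_mem hc h hdb
    have h5 : 0 ≤ o d := by simp only [o]; split_ifs <;> norm_num
    omega
  have hconst : ∀ x, x ∉ F.rootFace → h x = h u := fun x hx =>
    le_antisymm (hu x hx) (by rw [← hum, hlm]; exact hl x hx)
  intro hbO
  have h1 := hh b hbR hαbR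
  rw [hconst b hbR, hconst _ hαbR] at h1
  have h2 : o b = 1 := if_pos hbO
  have h3 : o₀ b = 0 := if_neg fun h => not_isBlossom_of_mem hc h hb
  omega

end MarkedMap

/-! ### First passage at the minimal label. -/

namespace PlaneMap

variable {D : Type*} {F : PlaneMap D} {p : ℕ}

theorem minPos_spec (F : PlaneMap D) :
    F.minPos ≤ F.N ∧ (∀ j ≤ F.N, F.minLabel ≤ F.lam j) ∧ ∀ j < F.minPos, F.minLabel < F.lam j := by
  have hmem : F.minPos ∈ {i | i ≤ F.N ∧ ∀ j ≤ F.N, F.lam i ≤ F.lam j} := by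
    apply Nat.sInf_mem
    obtain ⟨i, hi, hmin⟩ := Set.exists_min_image (Set.Iic F.N) F.lam (Set.finite_Iic _) ⟨0, by simp⟩
    exact ⟨i, hi, hmin⟩
  refine ⟨hmem.1, hmem.2, fun j hj => ?_⟩
  by_contra! hle
  have : j ∈ {i | i ≤ F.N ∧ ∀ j ≤ F.N, F.lam i ≤ F.lam j} :=
    ⟨hj.le.trans hmem.1, fun k hk => hle.trans (hmem.2 k hk)⟩
  exact absurd (Nat.sInf_le this) (not_le.2 hj)

/-- The first position after `a` at which one reaches the corner `κ_min`. -/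
theorem exists_target [Finite D] (h : F.lam F.N = -3) {a : ℕ} (ha : a < F.N) :
    ∃ m, a ≤ m ∧ F.ξ m = F.minDart ∧ (F.minPos = F.N → a ≠ m) ∧
      F.lam m = F.minLabel - 3 * (if a ≤ F.minPos then 0 else 1) ∧
      ∀ s, a ≤ s → s < m → F.lam m < F.lam s ∧ (∃ j, F.Before a j ∧ F.ξ j = F.ξ s) ∧
        (F.ξ s = F.minDart → F.minPos = F.N ∧ s = 0) := by
  obtain ⟨h1, h2, h3⟩ := F.minPos_spec
  by_cases hle : a ≤ F.minPos
  · refine ⟨F.minPos, hle, rfl, by omega, by simp [hle, minLabel], fun s hs hsm =>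
      ⟨h3 s hsm, ⟨s, Or.inl ⟨hle, hs, hsm⟩, rfl⟩, fun e => ?_⟩⟩
    rw [minDart, ξ_eq_iff, Nat.mod_eq_of_lt (hsm.trans_le h1)] at e
    rcases h1.lt_or_eq with hlt | heq
    · rw [Nat.mod_eq_of_lt hlt] at e
      omega
    -- Here `κ_min` is `ξ°`, which is the same dart as `ξ†`; position 0 is the only earlier
    -- occurrence.
    · rw [heq, Nat.mod_self] at e
      exact ⟨heq, e⟩
  · have hlt : F.minPos < a := not_le.1 hle
    -- `κ_min` has been passed, so it is met one turn later, where labels are lower by 3.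
    refine ⟨F.minPos + F.N, by omega, ξ_add_N _, by omega, ?_, fun s hs hsm => ?_⟩
    · rw [lam_add_N, h, if_neg hle, minLabel]; ring
    · have hlam : F.lam (F.minPos + F.N) = F.minLabel - 3 := by
        rw [lam_add_N, h, minLabel]; ring
      rw [hlam]
      rcases le_or_gt s F.N with hsN | hsN
      · refine ⟨by linarith [h2 s hsN], ⟨s, Or.inr ⟨hlt, Or.inl ⟨hs, hsN⟩⟩, rfl⟩, fun e => ?_⟩
        rw [minDart, ξ_eq_iff, Nat.mod_eq_of_lt (hlt.trans ha)] at e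
        rcases hsN.lt_or_eq with hsN | rfl
        · rw [Nat.mod_eq_of_lt hsN] at e
          omega
        -- At position `N` the dart is `ξ†`. It could be `κ_min` only if the minimal label were 0,
        -- but `ξ°` has label `-3`.
        · rw [Nat.mod_self] at e
          have h4 := h2 F.N le_rfl
          rw [h, minLabel, ← e, lam_zero] at h4
          omega
      · obtain ⟨j, rfl⟩ := Nat.exists_eq_add_of_lt hsN
        have e : F.N + j + 1 = j + 1 + F.N := by ring
        rw [e, lam_add_N, h, ξ_add_N]
        have hj : j + 1 < F.minPos := by omega
        refine ⟨by linarith [h3 _ hj], ⟨j + 1, Or.inr ⟨hlt, Or.inr hj⟩, rfl⟩, fun e => ?_⟩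
        rw [minDart, ξ_eq_iff, Nat.mod_eq_of_lt (hlt.trans ha),
          Nat.mod_eq_of_lt (hj.trans (hlt.trans ha))] at e
        omega

/-- No step can jump over `m`: before the next passage labels stay at least that of `T k`, which
exceeds that of `m` while `k < L`. So `T L ≤ m`, and equality holds since the two labels agree and
`m` is the first position with its label. -/
theorem eq_of_isSucc {T : ℕ → ℕ} (hT : ∀ k, F.IsSucc (T k) (T (k + 1))) {m L : ℕ} (hm : T 0 ≤ m)
    (hL : F.lam m = F.lam (T 0) - L) (hmin : ∀ s, T 0 ≤ s → s < m → F.lam m < F.lam s) :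
    T L = m := by
  have hlam : ∀ k, F.lam (T k) = F.lam (T 0) - k := by
    intro k
    induction k with
    | zero => simp
    | succ k ih => rw [(hT k).2.1, ih]; push_cast; ring
  have hmono : Monotone T := monotone_nat_of_le_succ fun k => (hT k).1.le
  have hle : ∀ k ≤ L, T k ≤ m := by
    intro k
    induction k with
    | zero => exact fun _ => hm
    | succ k ih =>
      intro hk
      have h1 := ih (by omega)
      have h2 := hlam k
      by_contra! h3
      rcases h1.lt_or_eq with h1 | h1
      · have := (hT k).2.2 m h1 h3
        omega
      · rw [h1] at h2
        omega
  rcases (hle L le_rfl).lt_or_eq with h | h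
  · have h1 := hmin _ (hmono (Nat.zero_le L)) h
    rw [hlam L] at h1
    omega
  · exact h

/-- If successive positions are each the first one with a smaller label, then the corner `κ_min` is
reached at the expected time. -/
theorem exists_hitting_time [Finite D] (h : F.lam F.N = -3) {T : ℕ → ℕ} (h0 : T 0 < F.N)
    (hT : ∀ k, F.IsSucc (T k) (T (k + 1))) :
    ∃ L : ℕ, (L : ℤ) = F.lam (T 0) - F.minLabel + 3 * (if T 0 ≤ F.minPos then 0 else 1) ∧
      F.ξ (T L) = F.minDart ∧ (F.minPos = F.N → L ≠ 0) ∧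
      ∀ i < L, (∃ j, F.Before (T 0) j ∧ F.ξ j = F.ξ (T i)) ∧
        (F.ξ (T i) = F.minDart → F.minPos = F.N ∧ i = 0) := by
  obtain ⟨m, hm, hξ, hne, hlam, hlt⟩ := exists_target h h0
  have hmono : StrictMono T := strictMono_nat_of_lt_succ fun k => (hT k).1
  obtain ⟨L, hL⟩ : ∃ L : ℕ, (L : ℤ) =
      F.lam (T 0) - F.minLabel + 3 * (if T 0 ≤ F.minPos then 0 else 1) := by
    have := F.minPos_spec.2.1 (T 0) h0.le
    exact Int.eq_ofNat_of_zero_le (by split_ifs <;> omega) |>.imp fun _ => Eq.symm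
  have hTL : T L = m := eq_of_isSucc hT hm (by rw [hlam, hL]; ring) fun s hs hs' => (hlt s hs hs').1
  refine ⟨L, hL, by rw [hTL, hξ], ?_, fun i hi => ?_⟩
  · rintro hN rfl
    exact hne hN hTL
  · obtain ⟨-, h1, h2⟩ := hlt (T i) (hmono.monotone (Nat.zero_le i)) (hTL ▸ hmono hi)
    refine ⟨h1, fun e => ?_⟩
    obtain ⟨h3, h4⟩ := h2 e
    have := hmono.id_le i
    exact ⟨h3, by simp only [id] at this; omega⟩

/-- The label of a vertex is the label of one of its corners. -/
theorem exists_lam_eq_vertexLabel [Finite D] (hF : F.IsCyclicForest p) (x : D) :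
    ∃ i < F.N, F.vert (F.ξ i) = F.vert x ∧ F.lam i = F.vertexLabel x := by
  let A : Set ℤ := {l | ∃ i < F.N, F.vert (F.ξ i) = F.vert x ∧ F.lam i = l}
  have hne : A.Nonempty := by
    obtain ⟨y, hy, hv⟩ : ∃ y, y ∉ F.rootFace ∧ F.vert y = F.vert x := by
      by_cases hx : x ∈ F.rootFace
      · exact ⟨F.σ x, hF.σ_notMem hx, F.vert_σ x⟩
      · exact ⟨x, hx, rfl⟩
    obtain ⟨i, hi, rfl⟩ := hF.exists_ξ hy
    exact ⟨_, i, hi, hv, rfl⟩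
  have hbdd : BddBelow A := by
    refine (((Set.finite_Iio F.N).image F.lam).subset ?_).bddBelow
    rintro _ ⟨i, hi, -, rfl⟩
    exact ⟨i, hi, rfl⟩
  exact Int.csInf_mem hne hbdd

end PlaneMap

theorem Equiv.Perm.eq_of_first_pow {D : Type*} {s : Equiv.Perm D} {y z z' : D} {Q : D → Prop}
    (hz : ∃ k, 0 < k ∧ z = (s ^ k) y ∧ Q z ∧ ∀ j, 0 < j → j < k → ¬ Q ((s ^ j) y))
    (hz' : ∃ k, 0 < k ∧ z' = (s ^ k) y ∧ Q z' ∧ ∀ j, 0 < j → j < k → ¬ Q ((s ^ j) y)) : z = z' := by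
  obtain ⟨k, hk, rfl, hQ, h⟩ := hz
  obtain ⟨k', hk', rfl, hQ', h'⟩ := hz'
  rcases lt_trichotomy k k' with hlt | rfl | hlt
  · exact absurd hQ (h' k hk hlt)
  · rfl
  · exact absurd hQ' (h k' hk' hlt)

/-! ### Modified leftmost paths as chains of first passages. -/

namespace MarkedMap

open PlaneMap

variable {D : Type*} {F : PlaneMap D} {p : ℕ} {M : MarkedMap D}

theorem IsPartialClosure.exists_nextDart (hG : IsPartialClosure F M)
    (hmax : ∀ b, ¬ M.IsBlossom b) {t : ℕ} (ht : ¬ F.IsBlossom (F.ξ t)) :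
    ∃ t', F.NextDart M.σ (F.α (F.ξ t)) (F.ξ t') ∧ F.IsSucc t t' := by
  by_cases hα : F.IsBlossom (F.α (F.ξ t))
  · exact hG.nextDart_blossom t hα (hmax _)
  · refine ⟨t + 1, ?_, by omega, ?_, fun s h h' => by omega⟩
    · rw [ξ_succ]; exact hG.nextDart _ hα
    · rw [lam_succ, incr, if_neg ht, if_neg hα]; rfl

theorem IsPartialClosure.exists_path (hG : IsPartialClosure F M)
    (hmax : ∀ b, ¬ M.IsBlossom b) {a : ℕ} (ha : ¬ F.IsBlossom (F.ξ a)) :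
    ∃ T : ℕ → ℕ, T 0 = a ∧ (∀ k, ¬ F.IsBlossom (F.ξ (T k))) ∧
      (∀ k, F.NextDart M.σ (F.α (F.ξ (T k))) (F.ξ (T (k + 1)))) ∧
      ∀ k, F.IsSucc (T k) (T (k + 1)) := by
  choose! g hg₁ hg₂ using fun t => hG.exists_nextDart hmax (t := t)
  have hnb : ∀ k, ¬ F.IsBlossom (F.ξ (g^[k] a)) := by
    intro k
    induction k with
    | zero => exact ha
    | succ k ih => rw [Function.iterate_succ_apply']; exact (hg₁ _ ih).not_isBlossom
  refine ⟨fun k => g^[k] a, rfl, hnb, fun k => ?_, fun k => ?_⟩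
  · simp only [Function.iterate_succ_apply']; exact hg₁ _ (hnb k)
  · simp only [Function.iterate_succ_apply']; exact hg₂ _ (hnb k)

/-- Only an inequality on the length, since a loop of the map contributes no step in the simple
graph. -/
theorem IsPartialClosure.exists_walk (hG : IsPartialClosure F M) {T : ℕ → ℕ}
    (hT : ∀ k, F.NextDart M.σ (F.α (F.ξ (T k))) (F.ξ (T (k + 1)))) (k : ℕ) :
    ∃ w : M.graph.Walk (M.vert (F.ξ (T 0))) (M.vert (F.ξ (T k))), w.length ≤ k := by
  induction k with
  | zero => exact ⟨.nil, le_rfl⟩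
  | succ k ih =>
    obtain ⟨w, hw⟩ := ih
    rw [(hT k).vert_eq]
    by_cases e : M.vert (F.ξ (T k)) = M.vert (F.α (F.ξ (T k)))
    · rw [← e]; exact ⟨w, by omega⟩
    · have hadj : M.graph.Adj (M.vert (F.ξ (T k))) (M.vert (F.α (F.ξ (T k)))) := by
        rw [PlaneMap.graph, SimpleGraph.fromRel_adj]
        exact ⟨e, Or.inl ⟨_, rfl, by rw [hG.α_eq]⟩⟩
      exact ⟨w.concat hadj, by rw [SimpleGraph.Walk.length_concat]; omega⟩

section

variable [Fintype D] [DecidableEq D] {O : Set D}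

/-- This removes the orientation from the path rule: a stem belongs to `O` exactly in the direction
of its blossom. -/
theorem IsMinimalOrientation.isProper_or_mem_iff (hF : F.IsBlossomingForest p) (hM : M.IsClosure F)
    (hO : M.IsMinimalOrientation O) (y : D) : (F.IsProper y ∨ y ∈ O) ↔ ¬ F.IsBlossom y := by
  constructor
  · rintro (h | h) hb
    · exact h.1 hb
    · exact hO.notMem_of_isBlossom hF hM hb h
  · intro h
    by_cases hα : F.IsBlossom (F.α y)
    · right
      rw [hO.1 y, (hM.properties hF).1.α_eq]
      exact hO.notMem_of_isBlossom hF hM hα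
    · exact Or.inl ⟨h, hα⟩

theorem IsMinimalOrientation.notMem_rootFace (hF : F.IsBlossomingForest p) (hM : M.IsClosure F)
    (hO : M.IsMinimalOrientation O) {d : D} (hd : d ∈ O) : d ∉ F.rootFace := fun h =>
  (hO.1 d).1 hd (hO.2.2.1 d ((hM.properties hF).1.face_eq_root_iff.2 h))

/-- Modified leftmost paths follow successive positions of the contour. -/
theorem IsMinimalOrientation.exists_positions (hF : F.IsBlossomingForest p) (hM : M.IsClosure F)
    (hO : M.IsMinimalOrientation O) {d : D} (hd : d ∈ O) :
    ∃ T : ℕ → ℕ, T 0 = F.pos d ∧ T 0 < F.N ∧ (∀ k, ¬ F.IsBlossom (F.ξ (T k))) ∧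
      (∀ k, F.IsSucc (T k) (T (k + 1))) ∧
      ∀ e : ℕ → D, (M.IsModifiedLeftmost F O e ∧ e 0 = d) ↔ e = fun k => F.ξ (T k) := by
  have hc := hF.isCyclicForest
  obtain ⟨hG, hnb, -, -⟩ := hM.properties hF
  have hdR := hO.notMem_rootFace hF hM hd
  have hpos := hc.ξ_pos hdR
  have hdb : ¬ F.IsBlossom d := fun h => hO.notMem_of_isBlossom hF hM h hd
  obtain ⟨T, hT₀, hTb, hTn, hTs⟩ := hG.exists_path hnb (a := F.pos d) (by rwa [hpos])
  have hfirst : ∀ k, ∃ n, 0 < n ∧ F.ξ (T (k + 1)) = (M.σ ^ n) (M.α (F.ξ (T k))) ∧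
      (F.IsProper (F.ξ (T (k + 1))) ∨ F.ξ (T (k + 1)) ∈ O) ∧ ∀ j, 0 < j → j < n →
      ¬ (F.IsProper ((M.σ ^ j) (M.α (F.ξ (T k)))) ∨ (M.σ ^ j) (M.α (F.ξ (T k))) ∈ O) := by
    intro k
    simp only [hO.isProper_or_mem_iff hF hM, not_not, hG.α_eq]
    obtain ⟨n, h1, h2, h3⟩ := (hTn k).exists_pow
    exact ⟨n, h1, h2, hTb _, h3⟩
  refine ⟨T, hT₀, hT₀ ▸ hc.pos_lt hdR, hTb, hTs, fun e => ⟨?_, ?_⟩⟩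
  · rintro ⟨⟨-, he⟩, he0⟩
    funext k
    induction k with
    | zero => rw [he0, hT₀, hpos]
    | succ k ih =>
      have h1 := he k
      rw [ih] at h1
      exact Equiv.Perm.eq_of_first_pow (Q := fun y => F.IsProper y ∨ y ∈ O) h1 (hfirst k)
  · rintro rfl
    have h0 : F.ξ (T 0) = d := by rw [hT₀, hpos]
    exact ⟨⟨by beta_reduce; rwa [h0], hfirst⟩, h0⟩

end

end MarkedMap

theorem proposition5 {D : Type*} [Fintype D] [DecidableEq D] (p : ℕ) (F : PlaneMap D)
    (hF : F.IsBlossomingForest p) (M : MarkedMap D) (hM : M.IsClosure F) :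
    (∀ O : Set D, M.IsMinimalOrientation O →
      (∀ d ∈ O, ∃! e : ℕ → D, M.IsModifiedLeftmost F O e ∧ e 0 = d) ∧
      (∀ e : ℕ → D, M.IsModifiedLeftmost F O e →
        (∃ i, M.vert (e i) = M.vert F.minDart) ∧
        ∃ L : ℕ,
          (L : ℤ) = F.label (e 0) - F.minLabel
            + 3 * (if F.pos (e 0) ≤ F.minPos then 0 else 1) ∧
          IsLeast {i | e i = F.minDart ∧ (F.minPos = F.N → i ≠ 0)} L ∧
          M.vert (e L) = M.vert F.minDart ∧
          ((∀ j, F.Before (F.pos (e 0)) j → F.vert (F.ξ j) ≠ F.vert F.minDart) →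
            IsLeast {i | M.vert (e i) = M.vert F.minDart} L))) ∧
    (∀ x : D, ¬ F.IsBlossom x →
      M.graph.Reachable (M.vert x) (M.vert F.minDart) ∧
      (M.graph.dist (M.vert x) (M.vert F.minDart) : ℤ) ≤ F.vertexLabel x - F.minLabel + 3) := by
  have hc := hF.isCyclicForest
  obtain ⟨hG, hnb, -, -⟩ := hM.properties hF
  refine ⟨fun O hO => ⟨fun d hd => ?_, fun e he => ?_⟩, fun x hx => ?_⟩
  · obtain ⟨T, -, -, -, -, hT⟩ := hO.exists_positions hF hM hd
    exact ⟨_, (hT _).2 rfl, fun e he => (hT e).1 he⟩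
  · obtain ⟨T, hT₀, hTN, hTb, hTs, hT⟩ := hO.exists_positions hF hM he.1
    have hξ : ∀ k, e k = F.ξ (T k) := congrFun ((hT e).1 ⟨he, rfl⟩)
    obtain ⟨L, hL, hmin, hL0, hlt⟩ := PlaneMap.exists_hitting_time hF.lam_N hTN hTs
    rw [hT₀] at hL
    have heL : e L = F.minDart := (hξ L).trans hmin
    refine ⟨⟨L, by rw [heL]⟩, L, hL, ⟨⟨heL, hL0⟩, ?_⟩, by rw [heL], fun hB => ⟨?_, ?_⟩⟩
    · rintro i ⟨hi, hi0⟩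
      by_contra! hiL
      obtain ⟨h1, h2⟩ := (hlt i hiL).2 (hξ i ▸ hi)
      exact hi0 h1 h2
    · exact congrArg M.vert heL
    -- An earlier visit to `v*` would be at a corner met before `κ_min`. Both darts start at proper
    -- vertices, so equality of their origins in `M` is equality in `F`.
    · intro i hi
      by_contra! hiL
      obtain ⟨j, hj, hji⟩ := (hlt i hiL).1
      refine hB j (hT₀ ▸ hj) ?_
      rw [hji, ← hG.vert_eq_iff (hTb i) (hmin ▸ hTb L), ← hξ]
      exact hi
  -- No orientation is needed: first passages from a corner of minimal label at the vertex give a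
  -- walk to `v*`, and the bound allows for `δ = 1`.
  · obtain ⟨i, hi, hv, hlam⟩ := PlaneMap.exists_lam_eq_vertexLabel hc x
    have hib : ¬ F.IsBlossom (F.ξ i) := fun h => hx (by
      rwa [← F.eq_of_vert_eq_of_isBlossom h hv] at h)
    obtain ⟨T, rfl, hTb, hTn, hTs⟩ := hG.exists_path hnb hib
    obtain ⟨L, hL, hmin, -, -⟩ := PlaneMap.exists_hitting_time hF.lam_N hi hTs
    obtain ⟨w, hw⟩ := hG.exists_walk hTn L
    rw [← hG.vert_eq_of_vert_eq hib hv, ← hmin]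
    refine ⟨⟨w⟩, ?_⟩
    have h1 := SimpleGraph.dist_le w
    rw [hlam] at hL
    split_ifs at hL <;> omega
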